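/- **Model.** There are $N$ agents. Agent $i$'s type $\theta_i$ is drawn, independently across agents, from a distribution $F_i$ on $\Theta_i=[\underline\theta_i,\bar\theta_i]$, $\underline\theta_i<\bar\theta_i$, with a continuous density $f_i$ that is strictly positive on the interior; $\Theta=\prod_i\Theta_i$. If agent $i$ with type $\theta_i$ gets the asset, his income $\pi_i$ is drawn from an integrable distribution $G_i(\cdot|\theta_i)$ on the interval $\Pi_i(\theta_i)=[\underline\pi_i(\theta_i),\bar\pi_i(\theta_i)]$ with $0\le\underline\pi_i(\theta_i)<\bar\pi_i(\theta_i)\le\infty$ (half-open if $\bar\pi_i(\theta_i)=\infty$), with a density $g_i(\cdot|\theta_i)$ that is continuous on $\Pi_i(\theta_i)$ and strictly positive on its interior. Let $\Pi_i=\bigcup_{\theta_i\in\Theta_i}\Pi_i(\theta_i)$. Assume: for $\pi_i\in\Pi_i$, $G_i(\pi_i|\theta_i)$ is continuously differentiable in $\theta_i$ wherever $\pi_i$ is not an end point of $\Pi_i(\theta_i)$, with partial derivative $G_{i,2}$; $G_{i,2}(\pi_i|\theta_i)<0$ whenever $\underline\theta_i<\theta_i<\bar\theta_i$ and $\underline\pi_i(\theta_i)<\pi_i<\bar\pi_i(\theta_i)$;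 there is a Lebesgue-integrable $b_i$ on $\Pi_i$ with $|G_i(\pi_i|\theta_i)-G_i(\pi_i|\theta_i')|\le b_i(\pi_i)|\theta_i-\theta_i'|$ for all $\pi_i\in\Pi_i$ and $\theta_i,\theta_i'\in\Theta_i$; and $\mathbf E[\pi_i|\theta_i]=\theta_i$. Auditing agent $i$ costs $c_i$, and $\phi_i\in[0,1]$ is given. A direct mechanism consists of measurable functions $q_i:\Theta\to[0,1]$ with $\sum_i q_i\le1$ (allocation), $t_i:\Theta\to\mathbf R$ (transfers), and, for reported profiles $\theta\in\Theta$, income reports $\pi_i'\in\Pi_i(\theta_i)$ and realized incomes $\pi_i\in\Pi_i$, royalties $r_i(\theta,\pi_i')\in\mathbf R$, auditing probabilities $a_i(\theta,\pi_i')\in[0,1]$ and penalties $p_i(\theta,\pi_i',\pi_i)\in\mathbf R$, such that the expectations below exist. Put $T_i(\theta_i')=\mathbf E_{\theta_{-i}}[t_i(\theta_i',\theta_{-i})]$, $$u_i(\theta_i',\pi_i'|\pi_i)=\mathbf E_{\theta_{-i}}\big[q_i(\theta_i',\theta_{-i})\big(\pi_i-r_i(\theta_i',\theta_{-i},\pi_i')-a_i(\theta_i',\theta_{-i},\pi_i')\,p_i(\theta_i',\theta_{-i},\pi_i',\pi_i)\big)\big],$$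 and $U_i(\theta_i'|\theta_i)=\mathbf E_{\pi_i|\theta_i}[u_i(\theta_i',\hat\pi_i|\pi_i)]$, where $\hat\pi_i$ is the point of $\Pi_i(\theta_i')$ closest to $\pi_i$. The mechanism is feasible if for every $i$: (a) $0\le p_i(\theta,\pi_i',\hat\pi)-p_i(\theta,\pi_i',\pi)\le(\hat\pi-\pi)\phi_i$ for all $\theta\in\Theta$, $\pi_i'\in\Pi_i(\theta_i)$ and $\pi<\hat\pi$ in $\Pi_i$; (b) $u_i(\theta_i,\pi_i|\pi_i)\ge u_i(\theta_i,\pi_i'|\pi_i)$ for all $\theta_i\in\Theta_i$ and $\pi_i,\pi_i'\in\Pi_i(\theta_i)$; (c) $U_i(\theta_i|\theta_i)-T_i(\theta_i)\ge U_i(\theta_i'|\theta_i)-T_i(\theta_i')$ for all $\theta_i,\theta_i'\in\Theta_i$; (d) $U_i(\theta_i|\theta_i)-T_i(\theta_i)\ge0$ for all $\theta_i\in\Theta_i$. It is optimal if it is feasible and maximizes $$\sum_{i}\mathbf E_\theta\Big[t_i(\theta)+q_i(\theta)\,\mathbf E_{\pi_i|\theta_i}\big[r_i(\theta,\pi_i)+a_i(\theta,\pi_i)\big(p_i(\theta,\pi_i,\pi_i)-c_i\big)\big]\Big]$$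 among all feasible mechanisms. **Capped-royalty mechanism (general costs).** Let $\mu_i(\theta_i,\pi_i)=-\frac{G_{i,2}(\pi_i|\theta_i)}{g_i(\pi_i|\theta_i)}\cdot\frac{1-F_i(\theta_i)}{f_i(\theta_i)}$, $\psi_i(\theta_i)=\theta_i-\frac{1-F_i(\theta_i)}{f_i(\theta_i)}+\mathbf E_{\pi_i|\theta_i}[(\mu_i(\theta_i,\pi_i)\phi_i-c_i)_+]$, $\pi_i^*(\theta_i)=0\vee\sup\{\pi_i\in\Pi_i(\theta_i):\mu_i(\theta_i,\pi_i)\phi_i\ge c_i\}$ and $\Phi_i(\theta_i)=-\phi_i\int_0^{\pi_i^*(\theta_i)}G_{i,2}(\pi_i|\theta_i)\,d\pi_i$. The mechanism $(q^*,t^*,r^*,a^*,p^*)$ is $$q_i^*(\theta)=[\psi_i(\theta_i)>\max_{j\ne i}\psi_j(\theta_j)_+],\quad a_i^*(\theta,\pi_i')=[\pi_i'<\pi_i^*(\theta_i)],\quad r_i^*(\theta,\pi_i')=\min\{\pi_i',\pi_i^*(\theta_i)\}\phi_i,\quad p_i^*(\theta,\pi_i',\pi_i)=(\pi_i-\pi_i')\phi_i,$$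 $$t_i^*(\theta)=q_i^*(\theta)\,\mathbf E_{\pi_i|\theta_i}[\pi_i-r_i^*(\theta,\pi_i)]-\int_{\underline\theta_i}^{\theta_i}q_i^*(z_i,\theta_{-i})[1-\Phi_i(z_i)]\,dz_i.$$ (Here $[\cdot]$ is the indicator of a predicate, and an empty maximum is $0$. At $\underline\theta_i$ and $\bar\theta_i$, virtual values are defined as limits from the interior, possibly $-\infty$.) **Corollary (Free auditing).** Suppose that $c_i=0$ for all $i$ and that, for each $i$, $$\psi_i^0(\theta_i)=\theta_i-(1-\phi_i)\frac{1-F_i(\theta_i)}{f_i(\theta_i)}$$ is strictly increasing in $\theta_i$. Then the following mechanism is optimal: $$q_i(\theta)=[\psi_i^0(\theta_i)>\max_{j\ne i}\psi_j^0(\theta_j)_+],\qquad t_i(\theta)=(1-\phi_i)\Big[q_i(\theta)\theta_i-\int_{\underline\theta_i}^{\theta_i}q_i(z_i,\theta_{-i})\,dz_i\Big],$$ $$a_i(\theta,\pi_i')=1,\qquad r_i(\theta,\pi_i')=\pi_i'\phi_i,\qquad p_i(\theta,\pi_i',\pi_i)=(\pi_i-\pi_i')\phi_i.$$ Moreover it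 is the capped-royalty mechanism: $q_i=q_i^*$ and $t_i=t_i^*$ on $\Theta$, and for all $\theta\in\Theta$, $\pi_i'\in\Pi_i(\theta_i)$ and $\pi_i\in\Pi_i$ one has $r_i=r_i^*$, $p_i=p_i^*$, and $a_i=a_i^*=1$ except possibly at the highest report $\pi_i'=\bar\pi_i(\theta_i)$. -/

import Mathlib

open MeasureTheory Set Filter Topology

noncomputable section

namespace RoyaltyAuction

/-- Primitives of the model with `N` agents: for each agent `i`, the type interval
`[tlo i, thi i]` with type density `f i`; for each type `x` of agent `i`, the end points
`incLo i x`, `incHi i x` (the upper one possibly `⊤`) of the income interval and the income density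
`g i x`; the auditing cost `c i`; and the maximal penalty sensitivity `φ i`. -/
structure Primitives (N : ℕ) where
  tlo : Fin N → ℝ
  thi : Fin N → ℝ
  f : Fin N → ℝ → ℝ
  incLo : Fin N → ℝ → ℝ
  incHi : Fin N → ℝ → EReal
  g : Fin N → ℝ → ℝ → ℝ
  c : Fin N → ℝ
  φ : Fin N → ℝ

/-- A direct mechanism `(q, t, r, a, p)`. Only the values at type profiles `θ ∈ Θ`, at report
histories `(θ, π') ∈ H_i` and at incomes `π ∈ Π_i` matter. Order of arguments: `r i θ π'`,
`a i θ π'`, `p i θ π' π` with `π'` the reported and `π` the realized income. -/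
structure Mechanism (N : ℕ) where
  q : Fin N → (Fin N → ℝ) → ℝ
  t : Fin N → (Fin N → ℝ) → ℝ
  r : Fin N → (Fin N → ℝ) → ℝ → ℝ
  a : Fin N → (Fin N → ℝ) → ℝ → ℝ
  p : Fin N → (Fin N → ℝ) → ℝ → ℝ → ℝ

namespace Primitives

variable {N : ℕ} (E : Primitives N)

/-- The type space `Θ_i`. -/
def types (i : Fin N) : Set ℝ := Icc (E.tlo i) (E.thi i)

/-- The space `Θ` of type profiles. -/
def profiles : Set (Fin N → ℝ) := {θ | ∀ i, θ i ∈ E.types i}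

/-- The income interval `Π_i(x)` of type `x` (half-open when the upper end point is `⊤`). -/
def incomes (i : Fin N) (x : ℝ) : Set ℝ := {y | E.incLo i x ≤ y ∧ (y : EReal) ≤ E.incHi i x}

/-- `Π_i`, the union of the income intervals of all types. -/
def allIncomes (i : Fin N) : Set ℝ := ⋃ x ∈ E.types i, E.incomes i x

/-- The set `H_i` of report histories `(θ', π')`. -/
def histories (i : Fin N) : Set ((Fin N → ℝ) × ℝ) :=
  {h | h.1 ∈ E.profiles ∧ h.2 ∈ E.incomes i (h.1 i)}

/-- The law of agent `i`'s type. -/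
def typeLaw (i : Fin N) : Measure ℝ :=
  (volume.restrict (E.types i)).withDensity fun x => ENNReal.ofReal (E.f i x)

/-- The law of the type profile: types are independent. -/
def profileLaw : Measure (Fin N → ℝ) := Measure.pi E.typeLaw

/-- The law of agent `i`'s income given that his type is `x`. -/
def incomeLaw (i : Fin N) (x : ℝ) : Measure ℝ :=
  (volume.restrict (E.incomes i x)).withDensity fun y => ENNReal.ofReal (E.g i x y)

/-- The distribution function `F_i`. -/
def F (i : Fin N) (x : ℝ) : ℝ := (E.typeLaw i).real (Iic x)

/-- The conditional distribution function `G_i(y | x)`. -/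
def G (i : Fin N) (y x : ℝ) : ℝ := (E.incomeLaw i x).real (Iic y)

/-- The partial derivative `G_{i,2}(y | x)` in the type (one-sided at the ends of `Θ_i`). -/
def G2 (i : Fin N) (y x : ℝ) : ℝ := derivWithin (fun z => E.G i y z) (E.types i) x

/-- The types `x` of agent `i` for which the income `y` is not an end point of `Π_i(x)`. -/
def nonBoundary (i : Fin N) (y : ℝ) : Set ℝ :=
  {x | x ∈ E.types i ∧ y ≠ E.incLo i x ∧ (y : EReal) ≠ E.incHi i x}

/-- The standing assumptions of the model. Densities may vanish at the end points of their
interval. Differentiability of `G_i(y | ·)` is required only at types for which `y` is not an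
end point of the income interval; the Lipschitz bound by an integrable function is required
for all incomes and types. -/
structure Standing : Prop where
  types_nondeg : ∀ i, E.tlo i < E.thi i
  f_cont : ∀ i, ContinuousOn (E.f i) (E.types i)
  f_pos : ∀ i, ∀ x ∈ Ioo (E.tlo i) (E.thi i), 0 < E.f i x
  f_prob : ∀ i, IsProbabilityMeasure (E.typeLaw i)
  incLo_nonneg : ∀ i, ∀ x ∈ E.types i, 0 ≤ E.incLo i x
  incLo_lt_incHi : ∀ i, ∀ x ∈ E.types i, (E.incLo i x : EReal) < E.incHi i x
  g_cont : ∀ i, ∀ x ∈ E.types i, ContinuousOn (E.g i x) (E.incomes i x)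
  g_pos : ∀ i, ∀ x ∈ E.types i, ∀ y : ℝ, E.incLo i x < y → (y : EReal) < E.incHi i x →
    0 < E.g i x y
  g_prob : ∀ i, ∀ x ∈ E.types i, IsProbabilityMeasure (E.incomeLaw i x)
  income_integrable : ∀ i, ∀ x ∈ E.types i, Integrable (fun y => y) (E.incomeLaw i x)
  /-- Types are normalized: the expected income of type `x` is `x`. -/
  income_mean : ∀ i, ∀ x ∈ E.types i, ∫ y, y ∂(E.incomeLaw i x) = x
  G_diff : ∀ i, ∀ y ∈ E.allIncomes i, ∀ x ∈ E.nonBoundary i y,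
    DifferentiableWithinAt ℝ (fun z => E.G i y z) (E.types i) x
  G2_cont : ∀ i, ∀ y ∈ E.allIncomes i, ContinuousOn (E.G2 i y) (E.nonBoundary i y)
  /-- A higher type has a higher income distribution. -/
  G2_neg : ∀ i, ∀ x ∈ Ioo (E.tlo i) (E.thi i), ∀ y : ℝ, E.incLo i x < y →
    (y : EReal) < E.incHi i x → E.G2 i y x < 0
  G_bound : ∀ i, ∃ b : ℝ → ℝ, IntegrableOn b (E.allIncomes i) ∧
    ∀ y ∈ E.allIncomes i, ∀ x ∈ E.types i, ∀ x' ∈ E.types i,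
      |E.G i y x - E.G i y x'| ≤ b y * |x - x'|
  φ_mem : ∀ i, E.φ i ∈ Icc (0 : ℝ) 1

/-! ### The principal's program -/

/-- `E_{θ_{-i}}[h(x, θ_{-i})]`: the coordinate `i` of the random profile is replaced by `x`. -/
def interim (i : Fin N) (x : ℝ) (h : (Fin N → ℝ) → ℝ) : ℝ :=
  ∫ θ, h (Function.update θ i x) ∂E.profileLaw

/-- The interim transfer rule `T_i`. -/
def T (M : Mechanism N) (i : Fin N) (x : ℝ) : ℝ := E.interim i x (M.t i)

/-- The utility `u_i(x', y' | y)` from type report `x'`, income report `y'`, true income `y`. -/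
def u (M : Mechanism N) (i : Fin N) (x' y' y : ℝ) : ℝ :=
  E.interim i x' fun θ => M.q i θ * (y - M.r i θ y' - M.a i θ y' * M.p i θ y' y)

/-- The point of `Π_i(x')` closest to `y`. -/
def proj (i : Fin N) (x' y : ℝ) : ℝ := max (E.incLo i x') (min (y : EReal) (E.incHi i x')).toReal

/-- The utility `U_i(x' | x)` of type `x` who reports type `x'` and then reports his income as
truthfully as possible. -/
def U (M : Mechanism N) (i : Fin N) (x' x : ℝ) : ℝ :=
  ∫ y, E.u M i x' (E.proj i x' y) y ∂(E.incomeLaw i x)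

/-- `M` is a direct mechanism: it takes its values in the right sets, it is measurable, and the
expectations that occur in the principal's program exist. -/
structure IsMechanism (M : Mechanism N) : Prop where
  q_nonneg : ∀ i, ∀ θ ∈ E.profiles, 0 ≤ M.q i θ
  q_sum : ∀ θ ∈ E.profiles, ∑ i, M.q i θ ≤ 1
  a_mem : ∀ i, ∀ h ∈ E.histories i, M.a i h.1 h.2 ∈ Icc (0 : ℝ) 1
  q_meas : ∀ i, Measurable (E.profiles.domRestrict (M.q i))
  t_meas : ∀ i, Measurable (E.profiles.domRestrict (M.t i))
  r_meas : ∀ i, Measurable ((E.histories i).domRestrict fun h => M.r i h.1 h.2)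
  a_meas : ∀ i, Measurable ((E.histories i).domRestrict fun h => M.a i h.1 h.2)
  p_meas : ∀ i, Measurable
    ((E.histories i ×ˢ E.allIncomes i).domRestrict fun k => M.p i k.1.1 k.1.2 k.2)
  t_integrable : ∀ i, Integrable (M.t i) E.profileLaw
  t_interim : ∀ i, ∀ x ∈ E.types i,
    Integrable (fun θ => M.t i (Function.update θ i x)) E.profileLaw
  pay_integrable : ∀ i, ∫⁻ θ, ∫⁻ y, ‖M.q i θ * (M.r i θ y + M.a i θ y * M.p i θ y y)‖ₑ
    ∂(E.incomeLaw i (θ i)) ∂E.profileLaw < ⊤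
  pay_interim : ∀ i, ∀ x ∈ E.types i, ∀ y' ∈ E.incomes i x, ∀ y ∈ E.allIncomes i,
    Integrable (fun θ => M.q i (Function.update θ i x) *
      (M.r i (Function.update θ i x) y' +
        M.a i (Function.update θ i x) y' * M.p i (Function.update θ i x) y' y)) E.profileLaw
  u_integrable : ∀ i, ∀ x' ∈ E.types i, ∀ x ∈ E.types i,
    Integrable (fun y => E.u M i x' (E.proj i x' y) y) (E.incomeLaw i x)

/-- Generalized double monotonicity of the penalties. -/
def DoubleMonotone (M : Mechanism N) : Prop :=
  ∀ i, ∀ h ∈ E.histories i, ∀ y ∈ E.allIncomes i, ∀ z ∈ E.allIncomes i, y < z →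
    0 ≤ M.p i h.1 h.2 z - M.p i h.1 h.2 y ∧
      M.p i h.1 h.2 z - M.p i h.1 h.2 y ≤ (z - y) * E.φ i

/-- Incentive compatibility at the income-reporting stage. -/
def ICIncome (M : Mechanism N) : Prop :=
  ∀ i, ∀ x ∈ E.types i, ∀ y ∈ E.incomes i x, ∀ y' ∈ E.incomes i x,
    E.u M i x y' y ≤ E.u M i x y y

/-- Incentive compatibility at the type-reporting stage. -/
def ICType (M : Mechanism N) : Prop :=
  ∀ i, ∀ x ∈ E.types i, ∀ x' ∈ E.types i, E.U M i x' x - E.T M i x' ≤ E.U M i x x - E.T M i x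

/-- Individual rationality. -/
def IR (M : Mechanism N) : Prop :=
  ∀ i, ∀ x ∈ E.types i, 0 ≤ E.U M i x x - E.T M i x

/-- The principal's feasible set. -/
structure Feasible (M : Mechanism N) : Prop where
  isMechanism : E.IsMechanism M
  doubleMonotone : E.DoubleMonotone M
  icIncome : E.ICIncome M
  icType : E.ICType M
  ir : E.IR M

/-- The principal's objective: expected payments net of auditing costs. -/
def objective (M : Mechanism N) : ℝ :=
  ∑ i, ∫ θ, (M.t i θ + M.q i θ *
    ∫ y, (M.r i θ y + M.a i θ y * (M.p i θ y y - E.c i)) ∂(E.incomeLaw i (θ i))) ∂E.profileLaw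

/-- `M` solves the principal's program. -/
def IsOptimal (M : Mechanism N) : Prop :=
  E.Feasible M ∧ ∀ M' : Mechanism N, E.Feasible M' → E.objective M' ≤ E.objective M

/-! ### Virtual values and the mechanism with general auditing costs -/

/-- `μ_i(x, y)`. -/
def μ (i : Fin N) (x y : ℝ) : ℝ :=
  -(E.G2 i y x / E.g i x y) * ((1 - E.F i x) / E.f i x)

/-- A function given by a formula at the interior types, extended to the two extreme types by
its limit there (the formula may be undefined at an extreme type, where the density may vanish).
The limit is written as a lower limit; it exists for monotone functions. -/
def extend (i : Fin N) (h : ℝ → ℝ) (x : ℝ) : EReal :=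
  open Classical in
  if x ∈ Ioo (E.tlo i) (E.thi i) then (h x : EReal)
  else liminf (fun z => (h z : EReal)) (𝓝[Ioo (E.tlo i) (E.thi i)] x)

/-- The virtual value `ψ_i`, at interior types. -/
def psiFormula (i : Fin N) (x : ℝ) : ℝ :=
  x - (1 - E.F i x) / E.f i x + ∫ y, max (E.μ i x y * E.φ i - E.c i) 0 ∂(E.incomeLaw i x)

/-- The free-auditing virtual value `ψ⁰_i`, at interior types. -/
def psi0Formula (i : Fin N) (x : ℝ) : ℝ :=
  x - (1 - E.φ i) * ((1 - E.F i x) / E.f i x)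

/-- The virtual value `ψ_i`. -/
def psi (i : Fin N) (x : ℝ) : EReal := E.extend i (E.psiFormula i) x

/-- The free-auditing virtual value `ψ⁰_i`. -/
def psi0 (i : Fin N) (x : ℝ) : EReal := E.extend i (E.psi0Formula i) x

/-- The auditing threshold `π*_i(x)`. -/
def threshold (i : Fin N) (x : ℝ) : EReal :=
  max 0 (sSup ((fun y : ℝ => (y : EReal)) '' {y ∈ E.incomes i x | E.c i ≤ E.μ i x y * E.φ i}))

/-- `Φ_i(x)`. -/
def Phi (i : Fin N) (x : ℝ) : ℝ :=
  -E.φ i * ∫ y in {y : ℝ | 0 ≤ y ∧ (y : EReal) ≤ E.threshold i x}, E.G2 i y x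

/-- The indicator of `v_i(θ_i) > max_{j ≠ i} v_j(θ_j)_+` (the empty maximum being `0`). -/
def allocate (v : Fin N → ℝ → EReal) (i : Fin N) (θ : Fin N → ℝ) : ℝ :=
  open Classical in
  if 0 < v i (θ i) ∧ ∀ j, j ≠ i → v j (θ j) < v i (θ i) then 1 else 0

/-- The royalty with cap: `min {π', π*_i(θ_i)} φ_i`. -/
def cappedRoyalty (i : Fin N) (θ : Fin N → ℝ) (y' : ℝ) : ℝ :=
  (min (y' : EReal) (E.threshold i (θ i))).toReal * E.φ i

/-- The mechanism `(q*, t*, r*, a*, p*)` with capped royalties, for general auditing costs. -/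
def cappedMechanism : Mechanism N where
  q := allocate E.psi
  t i θ := allocate E.psi i θ * (∫ y, (y - E.cappedRoyalty i θ y) ∂(E.incomeLaw i (θ i)))
    - ∫ z in (E.tlo i)..(θ i), allocate E.psi i (Function.update θ i z) * (1 - E.Phi i z)
  r := E.cappedRoyalty
  a i θ y' := open Classical in if (y' : EReal) < E.threshold i (θ i) then 1 else 0
  p i _ y' y := (y - y') * E.φ i

/-- The free-auditing mechanism: certain audits and linear royalties at rate `φ_i`. -/
def freeMechanism : Mechanism N where
  q := allocate E.psi0
  t i θ := (1 - E.φ i) * (allocate E.psi0 i θ * θ i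
    - ∫ z in (E.tlo i)..(θ i), allocate E.psi0 i (Function.update θ i z))
  r i _ y' := y' * E.φ i
  a _ _ _ := 1
  p i _ y' y := (y - y') * E.φ i

end Primitives

end RoyaltyAuction

end

namespace RoyaltyAuction

/-! ### Auxiliary facts of analysis and measure theory -/

/-! Upper bound on revenue. Write Q for the interim allocation and V for the rent of agent i. Fix a
type report x'. If income rises by d, the expected penalty rises by at most φ d times Q(x'), because
audit probabilities are at most one and penalties have slope in [0, φ]. Hence the utility from
reporting as truthfully as possible grows in income at rate at least (1 - φ) Q(x')
(`Feasible.truthful_u_sub_ge`). Subtracting this linear part leaves a function monotone in income,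
and income laws are ordered by stochastic dominance (`Standing.antitoneOn_G`). As type x has mean
income x, incentive compatibility yields V(x) - V(x') ≥ (1 - φ) Q(x') (x - x') for x' ≤ x
(`Feasible.rent_sub_ge`). These increments integrate to V(x) ≥ (1 - φ) ∫ Q (`Feasible.rent_ge`),
with no envelope theorem and no monotonicity of Q.

Free audits make revenue equal to expected income minus rents. Inserting the rent bound and
exchanging integrals bounds revenue by the expectation of ∑ q_i ψ⁰_i (`Feasible.objective_le`). Off
a null set of ties, giving the asset to the highest positive ψ⁰_i maximizes this sum pointwise.

Attainment. Under `freeMechanism` royalty and penalty add up to φ times the true income, whatever is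
reported, so the utility is exactly linear with slope (1 - φ) Q and the rent bound binds. Strict
monotonicity of ψ⁰ makes Q monotone, which gives incentive compatibility in types.

Agreement with the capped mechanism. Differentiating the identity "mean income of x is x" gives ∫ G2
dy = -1 (`Standing.integral_G2_Ioi`). Hence the expectation of μ φ is φ times the inverse hazard
rate, and Φ = φ. Since μ φ ≥ 0 = c in the interior, the audit threshold is the top of the income
interval. -/

theorem measurable_indicator_of_domRestrict {α : Type*} [MeasurableSpace α] {s : Set α}
    (hs : MeasurableSet s) {f : α → ℝ} (hf : Measurable (s.domRestrict f)) :
    Measurable (s.indicator f) := by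
  refine measurable_of_restrict_of_restrict_compl hs ?_ ?_
  · convert hf using 1
    ext x
    simp
  · have : sᶜ.domRestrict (s.indicator f) = fun _ => 0 := by
      ext x
      exact indicator_of_notMem x.2 f
    rw [this]
    exact measurable_const

/-- A continuous function with values in `[0, 1]` that decreases wherever it is not `0` or `1`
is antitone. -/
theorem antitoneOn_of_derivWithin_neg {a b : ℝ} {h : ℝ → ℝ} (hcont : ContinuousOn h (Icc a b))
    (h01 : ∀ x ∈ Icc a b, h x ∈ Icc (0 : ℝ) 1)
    (hneg : ∀ x ∈ Ioo a b, h x ∈ Ioo (0 : ℝ) 1 → derivWithin h (Icc a b) x < 0) :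
    AntitoneOn h (Icc a b) := by
  intro x₁ hx₁ x₂ hx₂ hle
  by_contra! hlt
  obtain ⟨m, hm1, hm2⟩ := exists_between hlt
  have hsub : Icc x₁ x₂ ⊆ Icc a b := Icc_subset_Icc hx₁.1 hx₂.2
  -- Let s be the last point of `[x₁, x₂]` with `h ≤ m`. Then `h s = m` lies strictly between 0 and
  -- 1, so the derivative at s is negative, yet `h > m` to the right of s makes the right difference
  -- quotients nonnegative.
  set K : Set ℝ := Icc x₁ x₂ ∩ h ⁻¹' Iic m with hK
  have hKc : IsClosed K := (hcont.mono hsub).preimage_isClosed_of_isClosed isClosed_Icc isClosed_Iic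
  have hKne : K.Nonempty := ⟨x₁, ⟨le_rfl, hle⟩, hm1.le⟩
  have hKb : BddAbove K := ⟨x₂, fun z hz => hz.1.2⟩
  set s := sSup K
  have hsK : s ∈ K := hKc.csSup_mem hKne hKb
  have habove : ∀ z ∈ Ioc s x₂, m < h z := by
    intro z hz
    by_contra! hc
    exact absurd (le_csSup hKb ⟨⟨hsK.1.1.trans hz.1.le, hz.2⟩, hc⟩) (not_le.2 hz.1)
  have hs2 : s < x₂ := by
    refine lt_of_le_of_ne hsK.1.2 fun h' => ?_
    have := hsK.2
    rw [mem_preimage, h', mem_Iic] at this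
    linarith
  have hright : Ioo s x₂ ∈ 𝓝[>] s := Ioo_mem_nhdsGT hs2
  have hsm : h s = m := by
    refine le_antisymm hsK.2 ?_
    have ht : Tendsto h (𝓝[>] s) (𝓝 (h s)) := by
      have := (hcont s (hsub hsK.1)).mono_left
        (nhdsWithin_mono (s := Ioo s x₂) (t := Icc a b) s
          fun z hz => hsub ⟨hsK.1.1.trans hz.1.le, hz.2.le⟩)
      rwa [nhdsWithin_Ioo_eq_nhdsGT hs2] at this
    exact ge_of_tendsto ht (mem_of_superset hright fun z hz => (habove z ⟨hz.1, hz.2.le⟩).le)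
  have hs1 : x₁ < s := by
    refine lt_of_le_of_ne hsK.1.1 fun h' => ?_
    rw [← h'] at hsm
    linarith
  have hsI : s ∈ Ioo a b := ⟨hx₁.1.trans_lt hs1, hs2.trans_le hx₂.2⟩
  have hd := hneg s hsI ⟨by rw [hsm]; exact lt_of_le_of_lt (h01 x₁ hx₁).1 hm1,
    by rw [hsm]; exact lt_of_lt_of_le hm2 (h01 x₂ hx₂).2⟩
  rw [derivWithin_of_mem_nhds (Icc_mem_nhds hsI.1 hsI.2)] at hd
  -- Differentiability is not assumed: `deriv` is 0 where it fails, so a negative value already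
  -- implies it.
  have hda : HasDerivAt h (deriv h s) s :=
    (differentiableAt_of_deriv_ne_zero hd.ne).hasDerivAt
  have hslope := (hasDerivAt_iff_tendsto_slope.1 hda).mono_left
    (nhdsWithin_mono s (fun z (hz : z ∈ Ioi s) => ne_of_gt hz))
  have : 0 ≤ deriv h s := by
    refine ge_of_tendsto hslope (mem_of_superset hright fun z hz => ?_)
    have h1 := habove z ⟨hz.1, hz.2.le⟩
    rw [mem_ofPred_eq, slope_def_field]
    exact div_nonneg (by linarith) (by linarith [hz.1])
  linarith

/-- If `V` grows at least at the rate `k`, then its increase is at least the integral of `k`. -/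
theorem intervalIntegral_le_sub_of_mul_le {a b : ℝ} (hab : a ≤ b) {V k : ℝ → ℝ}
    (hk : IntervalIntegrable k volume a b) (hk0 : ∀ z ∈ Icc a b, 0 ≤ k z)
    (h : ∀ z ∈ Icc a b, ∀ x ∈ Icc a b, z ≤ x → k z * (x - z) ≤ V x - V z) :
    ∫ z in a..b, k z ≤ V b - V a := by
  rcases hab.eq_or_lt with rfl | hlt
  · simp
  have hVm : MonotoneOn V (Icc a b) := fun z hz x hx hzx => by
    nlinarith [h z hz x hx hzx, mul_nonneg (hk0 z hz) (sub_nonneg.2 hzx)]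
  have hV : ∀ c ∈ Icc a b, ∀ d ∈ Icc a b, IntervalIntegrable V volume c d := fun c hc d hd =>
    (hVm.mono (by
                  rw [← uIcc_of_le hab]
                  exact uIcc_subset_uIcc (by rwa [uIcc_of_le hab]) (by rwa [uIcc_of_le hab]))).intervalIntegrable
  -- The function k need not be monotone, so Riemann sums are of no use. Instead `s * k z ≤ V (z +
  -- s) - V z` is integrated over `[a, b - s]`. The right side telescopes to the integrals of V over
  -- two end pieces of length s, which monotonicity bounds by `s * V b` and `s * V a`. Then s tends
  -- to 0.
  have key : ∀ s ∈ Ioo 0 (b - a), ∫ z in a..(b - s), k z ≤ V b - V a := by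
    intro s hs
    have hbs : b - s ∈ Icc a b := ⟨by linarith [hs.2], by linarith [hs.1]⟩
    have has : a + s ∈ Icc a b := ⟨by linarith [hs.1], by linarith [hs.2]⟩
    have ha : a ∈ Icc a b := ⟨le_rfl, hab⟩
    have hb : b ∈ Icc a b := ⟨hab, le_rfl⟩
    have hshift : IntervalIntegrable (fun z => V (z + s)) volume a (b - s) := by
      have := (hV (a + s) has b hb).comp_add_right s
      simpa using this
    have h1 : ∫ z in a..(b - s), s * k z ≤ ∫ z in a..(b - s), (V (z + s) - V z) := by
      refine intervalIntegral.integral_mono_on hbs.1 ?_ (hshift.sub (hV a ha _ hbs)) ?_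
      · exact (hk.mono_set (uIcc_subset_uIcc left_mem_uIcc
          (by rw [uIcc_of_le hab]; exact hbs))).const_mul s
      · intro z hz
        have := h z ⟨hz.1, hz.2.trans hbs.2⟩ (z + s) ⟨by linarith [hz.1, hs.1], by linarith [hz.2]⟩
          (by linarith [hs.1])
        nlinarith
    rw [intervalIntegral.integral_const_mul, intervalIntegral.integral_sub hshift (hV a ha _ hbs),
      intervalIntegral.integral_comp_add_right (fun z => V z), sub_add_cancel] at h1
    have e1 : (∫ z in (a + s)..b, V z) - ∫ z in a..(b - s), V z
        = (∫ z in (b - s)..b, V z) - ∫ z in a..(a + s), V z := by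
      have := intervalIntegral.integral_add_adjacent_intervals (hV a ha _ has) (hV _ has b hb)
      have := intervalIntegral.integral_add_adjacent_intervals (hV a ha _ hbs) (hV _ hbs b hb)
      linarith
    have h2 : ∫ z in (b - s)..b, V z ≤ ∫ _ in (b - s)..b, V b :=
      intervalIntegral.integral_mono_on hbs.2 (hV _ hbs b hb) (by simp)
        fun z hz => hVm ⟨hbs.1.trans hz.1, hz.2⟩ hb hz.2
    have h3 : ∫ _ in a..(a + s), V a ≤ ∫ z in a..(a + s), V z :=
      intervalIntegral.integral_mono_on has.1 (by simp) (hV a ha _ has)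
        fun z hz => hVm ha ⟨hz.1, hz.2.trans has.2⟩ hz.1
    simp only [intervalIntegral.integral_const, smul_eq_mul, sub_sub_cancel,
      add_sub_cancel_left] at h2 h3
    have : s * ∫ z in a..(b - s), k z ≤ s * (V b - V a) := by linarith
    exact le_of_mul_le_mul_left this hs.1
  have hcont : ContinuousWithinAt (fun x => ∫ z in a..x, k z) (Iio b) b :=
    ((intervalIntegral.continuousOn_primitive_interval' hk left_mem_uIcc) b right_mem_uIcc).mono_left
      (by
        rw [uIcc_of_le hab, ← nhdsWithin_Ico_eq_nhdsLT hlt]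
        exact nhdsWithin_mono _ Ico_subset_Icc_self)
  refine le_of_tendsto hcont ?_
  filter_upwards [Ioo_mem_nhdsLT hlt] with x hx
  have := key (b - x) ⟨by linarith [hx.2], by linarith [hx.1]⟩
  rwa [sub_sub_cancel] at this

/-! ### Expectations under first-order stochastic dominance. -/

section StochasticDominance

variable {μ ν : Measure ℝ} [IsProbabilityMeasure μ] [IsProbabilityMeasure ν] [NullSingletonClass ν]

/-- A bounded nonempty lower set is a half-line up to its supremum; whether it contains that point
is immaterial since ν has no atoms. -/
theorem measure_lowerSet_le (h : ∀ y, μ (Iic y) ≤ ν (Iic y)) {L : Set ℝ} (hL : IsLowerSet L) :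
    μ L ≤ ν L := by
  rcases L.eq_empty_or_nonempty with rfl | hne
  · simp
  by_cases hb : BddAbove L
  · calc μ L ≤ μ (Iic (sSup L)) := measure_mono fun z hz => le_csSup hb hz
      _ ≤ ν (Iic (sSup L)) := h _
      _ = ν (Iio (sSup L)) := (measure_congr Iio_ae_eq_Iic).symm
      _ ≤ ν L := measure_mono fun z hz => by
        obtain ⟨w, hw, hzw⟩ := exists_lt_of_lt_csSup hne hz
        exact hL hzw.le hw
  · have : L = univ := eq_univ_of_forall fun z => by
      obtain ⟨w, hw, hzw⟩ := not_bddAbove_iff.1 hb z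
      exact hL hzw.le hw
    simp [this]

theorem measure_upperSet_le (h : ∀ y, μ (Iic y) ≤ ν (Iic y)) {U : Set ℝ} (hU : IsUpperSet U) :
    ν U ≤ μ U := by
  have hm : MeasurableSet U := hU.ordConnected.measurableSet
  have h1 := measure_lowerSet_le h hU.compl
  rw [prob_compl_eq_one_sub hm, prob_compl_eq_one_sub hm] at h1
  exact (ENNReal.sub_le_sub_iff_left prob_le_one ENNReal.one_ne_top).1 h1

/-- As k is monotone only on S, its superlevel set need not be an upper set, but it agrees on S,
hence almost everywhere, with the upper set generated by its points in S. -/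
theorem measure_setOf_lt_le {S : Set ℝ} (hμ : ∀ᵐ y ∂μ, y ∈ S)
    (hν : ∀ᵐ y ∂ν, y ∈ S) (h : ∀ y, μ (Iic y) ≤ ν (Iic y)) {k : ℝ → ℝ} (hk : MonotoneOn k S)
    (t : ℝ) : ν {y | t < k y} ≤ μ {y | t < k y} := by
  set U : Set ℝ := {y | ∃ z ∈ S, t < k z ∧ z ≤ y}
  have hU : IsUpperSet U := fun y y' hyy' ⟨z, hz, hkz, hzy⟩ => ⟨z, hz, hkz, hzy.trans hyy'⟩
  have hiff : ∀ y ∈ S, y ∈ U ↔ t < k y := fun y hy =>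
    ⟨fun ⟨z, hz, hkz, hzy⟩ => hkz.trans_le (hk hz hy hzy), fun hky => ⟨y, hy, hky, le_rfl⟩⟩
  have e1 : ν {y | t < k y} = ν U := measure_congr (by
    filter_upwards [hν] with y hy
    exact propext (hiff y hy).symm)
  have e2 : μ {y | t < k y} = μ U := measure_congr (by
    filter_upwards [hμ] with y hy
    exact propext (hiff y hy).symm)
  rw [e1, e2]
  exact measure_upperSet_le h hU

theorem measure_setOf_lt_neg_le {S : Set ℝ} (hμ : ∀ᵐ y ∂μ, y ∈ S)
    (hν : ∀ᵐ y ∂ν, y ∈ S) (h : ∀ y, μ (Iic y) ≤ ν (Iic y)) {k : ℝ → ℝ} (hk : MonotoneOn k S)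
    (t : ℝ) : μ {y | t < -k y} ≤ ν {y | t < -k y} := by
  set L : Set ℝ := {y | ∃ z ∈ S, t < -k z ∧ y ≤ z}
  have hL : IsLowerSet L := fun y y' hyy' ⟨z, hz, hkz, hzy⟩ => ⟨z, hz, hkz, hyy'.trans hzy⟩
  have hiff : ∀ y ∈ S, y ∈ L ↔ t < -k y := fun y hy =>
    ⟨fun ⟨z, hz, hkz, hzy⟩ => hkz.trans_le (neg_le_neg (hk hy hz hzy)),
      fun hky => ⟨y, hy, hky, le_rfl⟩⟩
  have e1 : ν {y | t < -k y} = ν L := measure_congr (by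
    filter_upwards [hν] with y hy
    exact propext (hiff y hy).symm)
  have e2 : μ {y | t < -k y} = μ L := measure_congr (by
    filter_upwards [hμ] with y hy
    exact propext (hiff y hy).symm)
  rw [e1, e2]
  exact measure_lowerSet_le h hL

/-- The expectation of a monotone function is monotone in first-order stochastic dominance. -/
theorem integral_le_of_stochasticDominance {S : Set ℝ} (hμ : ∀ᵐ y ∂μ, y ∈ S)
    (hν : ∀ᵐ y ∂ν, y ∈ S) (h : ∀ y, μ (Iic y) ≤ ν (Iic y)) {k : ℝ → ℝ}
    (hk : MonotoneOn k S) (hkμ : Integrable k μ) (hkν : Integrable k ν) :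
    ∫ y, k y ∂ν ≤ ∫ y, k y ∂μ := by
  -- Layer-cake formula for the positive part of l. It is applied to k and to -k, whose superlevel
  -- sets are compared in opposite directions.
  have layer : ∀ (ρ : Measure ℝ) (l : ℝ → ℝ), Integrable l ρ →
      ∫⁻ y, ENNReal.ofReal (l y) ∂ρ = ∫⁻ t in Ioi (0 : ℝ), ρ {y | t < l y} := by
    intro ρ l hl
    have := lintegral_eq_lintegral_meas_lt ρ (f := fun y => max (l y) 0)
      (ae_of_all _ fun y => le_max_right _ _) (hl.aemeasurable.max aemeasurable_const)
    have e : ∀ y, ENNReal.ofReal (max (l y) 0) = ENNReal.ofReal (l y) := fun y => by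
      rw [ENNReal.ofReal_max]
      simp
    simp only [e] at this
    rw [this]
    refine setLIntegral_congr_fun measurableSet_Ioi fun t ht => ?_
    have : {y | t < max (l y) 0} = {y | t < l y} := by
      ext y
      simp [not_lt.2 (le_of_lt (mem_Ioi.1 ht))]
    rw [this]
  rw [integral_eq_lintegral_pos_part_sub_lintegral_neg_part hkμ,
    integral_eq_lintegral_pos_part_sub_lintegral_neg_part hkν]
  have fin : ∀ (ρ : Measure ℝ) (l : ℝ → ℝ), Integrable l ρ →
      ∫⁻ y, ENNReal.ofReal (l y) ∂ρ ≠ ⊤ := fun ρ l hl =>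
    ((lintegral_mono fun y => Real.ofReal_le_enorm _).trans_lt hl.2).ne
  refine sub_le_sub (ENNReal.toReal_mono (fin _ _ hkμ) ?_)
    (ENNReal.toReal_mono (fin _ _ hkν.neg) ?_)
  · rw [layer _ _ hkμ, layer _ _ hkν]
    exact lintegral_mono fun t => measure_setOf_lt_le hμ hν h hk t
  · have e1 := layer _ _ hkμ.neg
    have e2 := layer _ _ hkν.neg
    simp only [Pi.neg_apply] at e1 e2
    rw [e1, e2]
    exact lintegral_mono fun t => measure_setOf_lt_neg_le hμ hν h hk t

end StochasticDominance

/-- Redrawing one coordinate of a vector of independent coordinates preserves its law. -/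
theorem measurePreserving_update {ι : Type*} [Fintype ι] [DecidableEq ι]
    (μ : ι → Measure ℝ) [∀ i, IsProbabilityMeasure (μ i)] (i : ι) :
    MeasurePreserving (fun k : (ι → ℝ) × ℝ => Function.update k.1 i k.2)
      ((Measure.pi μ).prod (μ i)) (Measure.pi μ) := by
  have hm : Measurable (fun k : (ι → ℝ) × ℝ => Function.update k.1 i k.2) := by
    refine measurable_pi_lambda _ fun j => ?_
    by_cases hj : j = i
    · subst hj
      simpa using measurable_snd
    · simp only [Function.update_of_ne hj]
      exact (measurable_pi_apply j).comp measurable_fst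
  refine ⟨hm, (Measure.pi_eq fun s hs => ?_).symm⟩
  rw [Measure.map_apply hm (MeasurableSet.univ_pi hs)]
  have : (fun k : (ι → ℝ) × ℝ => Function.update k.1 i k.2) ⁻¹' univ.pi s
      = (univ.pi (Function.update s i univ)) ×ˢ s i := by
    ext ⟨θ, x⟩
    simp only [mem_preimage, Set.mem_pi, mem_univ, true_imp_iff, mem_prod]
    constructor
    · intro h
      refine ⟨fun j => ?_, by simpa using h i⟩
      by_cases hj : j = i
      · subst hj; simp
      · simpa [hj] using h j
    · rintro ⟨h1, h2⟩ j
      by_cases hj : j = i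
      · subst hj; simpa using h2
      · simpa [hj] using h1 j
  rw [this, Measure.prod_prod, Measure.pi_pi, ← Finset.prod_erase_mul _ _ (Finset.mem_univ i),
    ← Finset.prod_erase_mul (s := Finset.univ) (f := fun j => μ j (s j)) (Finset.mem_univ i)]
  simp only [Function.update_self, measure_univ, mul_one]
  congr 1
  refine Finset.prod_congr rfl fun j hj => ?_
  rw [Function.update_of_ne (Finset.ne_of_mem_erase hj)]

end RoyaltyAuction

namespace RoyaltyAuction.Primitives

variable {N : ℕ} {E : Primitives N}

/-! ### Income distributions -/

theorem measurableSet_incomes (i : Fin N) (x : ℝ) : MeasurableSet (E.incomes i x) :=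
  measurableSet_Ici.inter (measurable_coe_real_ereal measurableSet_Iic)

theorem ae_mem_incomes (i : Fin N) (x : ℝ) : ∀ᵐ y ∂E.incomeLaw i x, y ∈ E.incomes i x :=
  (withDensity_absolutelyContinuous _ _).ae_le (ae_restrict_mem (measurableSet_incomes i x))

theorem incomes_subset_allIncomes {i : Fin N} {x : ℝ} (hx : x ∈ E.types i) :
    E.incomes i x ⊆ E.allIncomes i :=
  subset_biUnion_of_mem (u := fun x => E.incomes i x) hx

theorem ae_mem_allIncomes {i : Fin N} {x : ℝ} (hx : x ∈ E.types i) :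
    ∀ᵐ y ∂E.incomeLaw i x, y ∈ E.allIncomes i :=
  (ae_mem_incomes i x).mono fun _ hy => incomes_subset_allIncomes hx hy

instance (i : Fin N) (x : ℝ) : NullSingletonClass (E.incomeLaw i x) := by
  unfold incomeLaw
  infer_instance

instance (i : Fin N) : NullSingletonClass (E.typeLaw i) := by
  unfold typeLaw
  infer_instance

theorem G_nonneg (i : Fin N) (y x : ℝ) : 0 ≤ E.G i y x := measureReal_nonneg

namespace Standing

variable (hE : E.Standing)

theorem ae_mem_interior_incomes (i : Fin N) (x : ℝ) :
    ∀ᵐ y ∂volume.restrict (E.incomes i x), E.incLo i x < y ∧ (y : EReal) < E.incHi i x := by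
  have h1 : ∀ᵐ y ∂volume.restrict (E.incomes i x), y ≠ E.incLo i x :=
    Measure.ae_ne _ _
  -- If the upper end point is `⊤`, its `toReal` is 0, and one irrelevant null point is excluded.
  have h2 : ∀ᵐ y ∂volume.restrict (E.incomes i x), y ≠ (E.incHi i x).toReal :=
    Measure.ae_ne _ _
  filter_upwards [h1, h2, ae_restrict_mem (measurableSet_incomes i x)] with y h1 h2 h3
  refine ⟨lt_of_le_of_ne h3.1 h1.symm, lt_of_le_of_ne h3.2 fun h => h2 ?_⟩
  rw [← h, EReal.toReal_coe]

include hE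

theorem G_le_one {i : Fin N} {x : ℝ} (hx : x ∈ E.types i) (y : ℝ) : E.G i y x ≤ 1 :=
  have := hE.g_prob i x hx
  measureReal_le_one

theorem aemeasurable_g {i : Fin N} {x : ℝ} (hx : x ∈ E.types i) :
    AEMeasurable (fun y => ENNReal.ofReal (E.g i x y)) (volume.restrict (E.incomes i x)) :=
  ((hE.g_cont i x hx).aemeasurable (measurableSet_incomes i x)).ennreal_ofReal

/-- A mean lies between the bounds of its distribution. This places types and incomes on the same
line and is what keeps the union of the income intervals connected. -/
theorem mean_mem_incomes {i : Fin N} {x : ℝ} (hx : x ∈ E.types i) : x ∈ E.incomes i x := by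
  have := hE.g_prob i x hx
  have hint := hE.income_integrable i x hx
  have hmean := hE.income_mean i x hx
  constructor
  · have := integral_mono_ae (integrable_const (E.incLo i x)) hint
      ((ae_mem_incomes i x).mono fun y hy => hy.1)
    simpa [hmean] using this
  · rcases eq_or_ne (E.incHi i x) ⊤ with h | h
    · simp [h]
    have hbot : E.incHi i x ≠ ⊥ := ((EReal.bot_lt_coe _).trans (hE.incLo_lt_incHi i x hx)).ne'
    lift E.incHi i x to ℝ using ⟨h, hbot⟩ with m hm
    have := integral_mono_ae hint (integrable_const m)
      ((ae_mem_incomes i x).mono fun y hy => by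
        have := hy.2
        rwa [← hm, EReal.coe_le_coe_iff] at this)
    rw [EReal.coe_le_coe_iff]
    simpa [hmean] using this

theorem types_subset_allIncomes (i : Fin N) : E.types i ⊆ E.allIncomes i := fun _ hx =>
  incomes_subset_allIncomes hx (hE.mean_mem_incomes hx)

/-- Every type is one of its own incomes, so an income that no type can have lies below `tlo` or
above `thi`, and therefore on the same side of all income intervals. For such y, on which the
assumptions on G are silent, G does not depend on the type. -/
theorem lt_incLo_or_incHi_lt {i : Fin N} {y : ℝ} (hy : y ∉ E.allIncomes i) :
    (∀ x ∈ E.types i, y < E.incLo i x) ∨ ∀ x ∈ E.types i, E.incHi i x < (y : EReal) := by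
  have hcases : ∀ x ∈ E.types i, y < E.incLo i x ∨ E.incHi i x < (y : EReal) := by
    intro x hx
    by_contra! hc
    exact hy (incomes_subset_allIncomes hx hc)
  have hyt : y ∉ E.types i := fun h => hy (hE.types_subset_allIncomes i h)
  rcases lt_or_ge y (E.tlo i) with hlt | hge
  · refine Or.inl fun x hx => (hcases x hx).resolve_right fun h => ?_
    have := (hE.mean_mem_incomes hx).2.trans_lt h
    rw [EReal.coe_lt_coe_iff] at this
    linarith [hx.1]
  · have hgt : E.thi i < y := by
      by_contra! hc
      exact hyt ⟨hge, hc⟩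
    refine Or.inr fun x hx => (hcases x hx).resolve_left fun h => ?_
    linarith [hx.2, (hE.mean_mem_incomes hx).1]

/-- Gives measurability of the set, which is an uncountable union. -/
theorem ordConnected_allIncomes (i : Fin N) : (E.allIncomes i).OrdConnected := by
  refine ⟨fun y₁ h₁ y₂ h₂ y hy => ?_⟩
  by_contra hc
  simp only [allIncomes, mem_iUnion] at h₁ h₂
  obtain ⟨x₁, hx₁, h₁⟩ := h₁
  obtain ⟨x₂, hx₂, h₂⟩ := h₂
  rcases hE.lt_incLo_or_incHi_lt hc with h | h
  · linarith [h x₁ hx₁, h₁.1, hy.1]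
  · have := h₂.2.trans_lt (h x₂ hx₂)
    rw [EReal.coe_lt_coe_iff] at this
    linarith [hy.2]

theorem measurableSet_allIncomes (i : Fin N) : MeasurableSet (E.allIncomes i) :=
  (hE.ordConnected_allIncomes i).measurableSet

omit hE in
theorem G_eq_zero {i : Fin N} {x y : ℝ} (h : y ≤ E.incLo i x) :
    E.G i y x = 0 := by
  have : ∀ᵐ z ∂E.incomeLaw i x, z ∉ Iic y := by
    filter_upwards [ae_mem_incomes i x, Measure.ae_ne (E.incomeLaw i x) y] with z hz hzy hle
    exact hzy (le_antisymm hle (h.trans hz.1))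
  rw [G, measureReal_def, measure_eq_zero_iff_ae_notMem.2 this, ENNReal.toReal_zero]

theorem G_eq_one {i : Fin N} {x y : ℝ} (hx : x ∈ E.types i) (h : E.incHi i x ≤ (y : EReal)) :
    E.G i y x = 1 := by
  have := hE.g_prob i x hx
  have : ∀ᵐ z ∂E.incomeLaw i x, z ∈ Iic y := by
    filter_upwards [ae_mem_incomes i x] with z hz
    exact EReal.coe_le_coe_iff.1 (hz.2.trans h)
  rw [G, measureReal_def, (prob_compl_eq_zero_iff measurableSet_Iic).1 this, ENNReal.toReal_one]

theorem incomeLaw_pos {i : Fin N} {x : ℝ} (hx : x ∈ E.types i) {a b : ℝ} (hab : a < b)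
    (ha : E.incLo i x ≤ a) (hb : (b : EReal) ≤ E.incHi i x) :
    E.incomeLaw i x (Ioo a b) ≠ 0 := by
  have hsub : ∀ z ∈ Ioo a b, E.incLo i x < z ∧ (z : EReal) < E.incHi i x := fun z hz =>
    ⟨ha.trans_lt hz.1, (EReal.coe_lt_coe_iff.2 hz.2).trans_le hb⟩
  rw [incomeLaw, Ne, withDensity_apply_eq_zero' (hE.aemeasurable_g hx)]
  have : {z | ENNReal.ofReal (E.g i x z) ≠ 0} ∩ Ioo a b = Ioo a b :=
    inter_eq_right.2 fun z hz =>
      (ENNReal.ofReal_pos.2 (hE.g_pos i x hx z (hsub z hz).1 (hsub z hz).2)).ne'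
  rw [this, Measure.restrict_apply measurableSet_Ioo,
    inter_eq_left.2 (show Ioo a b ⊆ E.incomes i x from
      fun z hz => ⟨(hsub z hz).1.le, (hsub z hz).2.le⟩)]
  simp [hab]

theorem G_pos {i : Fin N} {x y : ℝ} (hx : x ∈ E.types i) (h : E.incLo i x < y) :
    0 < E.G i y x := by
  have := hE.g_prob i x hx
  refine lt_of_le_of_ne (G_nonneg i y x) fun h0 => ?_
  obtain ⟨m, hm1, hm2⟩ := EReal.lt_iff_exists_real_btwn.1
    (lt_min (hE.incLo_lt_incHi i x hx) (EReal.coe_lt_coe_iff.2 h))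
  rw [EReal.coe_lt_coe_iff] at hm1
  refine hE.incomeLaw_pos hx hm1 le_rfl (hm2.le.trans (min_le_left _ _)) ?_
  have h0' : E.incomeLaw i x (Iic y) = 0 := by
    rw [G, measureReal_def, eq_comm, ENNReal.toReal_eq_zero_iff] at h0
    exact h0.resolve_right (measure_ne_top _ _)
  refine measure_mono_null (fun z hz => ?_) h0'
  have := EReal.coe_lt_coe_iff.1 (hm2.trans_le (min_le_right _ _))
  exact (hz.2.trans this).le

theorem G_lt_one {i : Fin N} {x y : ℝ} (hx : x ∈ E.types i) (h : (y : EReal) < E.incHi i x) :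
    E.G i y x < 1 := by
  have := hE.g_prob i x hx
  refine lt_of_le_of_ne (hE.G_le_one hx y) fun h1 => ?_
  obtain ⟨m, hm1, hm2⟩ := EReal.lt_iff_exists_real_btwn.1
    (max_lt (hE.incLo_lt_incHi i x hx) h)
  have hm3 : max (E.incLo i x) y < m := by
    rw [max_lt_iff] at hm1 ⊢
    exact ⟨EReal.coe_lt_coe_iff.1 hm1.1, EReal.coe_lt_coe_iff.1 hm1.2⟩
  refine hE.incomeLaw_pos hx hm3 (le_max_left _ _) hm2.le ?_
  have h1' : E.incomeLaw i x (Iic y)ᶜ = 0 := by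
    rw [prob_compl_eq_zero_iff measurableSet_Iic]
    rw [G, measureReal_def] at h1
    rw [← ENNReal.ofReal_toReal (measure_ne_top _ (Iic y)), h1, ENNReal.ofReal_one]
  refine measure_mono_null (fun z hz => ?_) h1'
  exact not_le.2 ((le_max_right _ _).trans_lt hz.1)

theorem mem_interior_of_G_mem {i : Fin N} {x y : ℝ} (hx : x ∈ E.types i)
    (h : E.G i y x ∈ Ioo (0 : ℝ) 1) : E.incLo i x < y ∧ (y : EReal) < E.incHi i x := by
  by_contra! hc
  rcases le_or_gt y (E.incLo i x) with h1 | h1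
  · exact h.1.ne' (G_eq_zero h1)
  · exact h.2.ne (hE.G_eq_one hx (hc h1))

theorem G_const {i : Fin N} {y : ℝ} (hy : y ∉ E.allIncomes i) :
    ∃ k, ∀ x ∈ E.types i, E.G i y x = k := by
  rcases hE.lt_incLo_or_incHi_lt hy with h | h
  · exact ⟨0, fun x hx => G_eq_zero (h x hx).le⟩
  · exact ⟨1, fun x hx => hE.G_eq_one hx (h x hx).le⟩

/-- Income distributions are ordered by first-order stochastic dominance. -/
theorem antitoneOn_G (i : Fin N) (y : ℝ) : AntitoneOn (fun x => E.G i y x) (E.types i) := by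
  by_cases hy : y ∈ E.allIncomes i
  · refine antitoneOn_of_derivWithin_neg ?_ (fun x hx => ⟨G_nonneg i y x, hE.G_le_one hx y⟩) ?_
    -- The Lipschitz bound supplies continuity also at types for which y is an end point of the
    -- income interval, where differentiability is not assumed.
    · obtain ⟨b, -, hb⟩ := hE.G_bound i
      have : LipschitzOnWith (Real.nnabs (b y)) (fun x => E.G i y x) (E.types i) :=
        LipschitzOnWith.of_dist_le_mul fun x hx x' hx' => by
          rw [Real.dist_eq, Real.dist_eq]
          exact (hb y hy x hx x' hx').trans
            (mul_le_mul_of_nonneg_right (le_abs_self _) (abs_nonneg _))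
      exact this.continuousOn
    · intro x hx hG
      have := hE.mem_interior_of_G_mem (Ioo_subset_Icc_self hx) hG
      exact hE.G2_neg i x hx y this.1 this.2
  · obtain ⟨k, hk⟩ := hE.G_const hy
    intro x hx x' hx' _
    simp only [hk x hx, hk x' hx', le_refl]

/-- If the lower end point fell, the higher type would put mass where the lower type has none,
against stochastic dominance. Monotonicity of the two end points makes `E.histories i` measurable.
-/
theorem monotoneOn_incLo (i : Fin N) : MonotoneOn (E.incLo i) (E.types i) := by
  intro x hx x' hx' hle
  by_contra! hlt
  have h1 := hE.antitoneOn_G i (E.incLo i x) hx hx' hle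
  simp only [G_eq_zero (le_refl (E.incLo i x))] at h1
  exact absurd (hE.G_pos hx' hlt) (not_lt.2 h1)

theorem monotoneOn_incHi (i : Fin N) : MonotoneOn (E.incHi i) (E.types i) := by
  intro x hx x' hx' hle
  by_contra! hlt
  obtain ⟨y, hy1, hy2⟩ := EReal.lt_iff_exists_real_btwn.1 hlt
  have h1 := hE.antitoneOn_G i y hx hx' hle
  simp only [hE.G_eq_one hx' hy1.le] at h1
  exact absurd (hE.G_lt_one hx hy2) (not_lt.2 h1)

/-- Here G attains its extreme value 0 or 1 at x, so x is a local extremum of `G(y | ·)`. The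
derivative vanishes by Fermat's rule, or by default if it does not exist. -/
theorem G2_eq_zero {i : Fin N} {x y : ℝ} (hx : x ∈ Ioo (E.tlo i) (E.thi i))
    (h : y ≤ E.incLo i x ∨ E.incHi i x ≤ (y : EReal)) : E.G2 i y x = 0 := by
  have hnhds : E.types i ∈ 𝓝 x := Icc_mem_nhds hx.1 hx.2
  rw [G2, derivWithin_of_mem_nhds hnhds]
  rcases h with h | h
  · refine IsLocalMin.deriv_eq_zero (Eventually.of_forall fun z => ?_)
    exact (G_eq_zero h).trans_le (G_nonneg i y z)
  · refine IsLocalMax.deriv_eq_zero ?_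
    filter_upwards [hnhds] with z hz
    exact (hE.G_le_one hz y).trans_eq (hE.G_eq_one (Ioo_subset_Icc_self hx) h).symm

theorem hasDerivAt_G {i : Fin N} {x y : ℝ} (hx : x ∈ Ioo (E.tlo i) (E.thi i))
    (h1 : y ≠ E.incLo i x) (h2 : (y : EReal) ≠ E.incHi i x) :
    HasDerivAt (fun z => E.G i y z) (E.G2 i y x) x := by
  have hnhds : E.types i ∈ 𝓝 x := Icc_mem_nhds hx.1 hx.2
  by_cases hy : y ∈ E.allIncomes i
  · exact (hE.G_diff i y hy x ⟨Ioo_subset_Icc_self hx, h1, h2⟩).hasDerivWithinAt.hasDerivAt hnhds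
  · obtain ⟨k, hk⟩ := hE.G_const hy
    have hd : HasDerivAt (fun z => E.G i y z) 0 x :=
      (hasDerivAt_const x k).congr_of_eventuallyEq (by filter_upwards [hnhds] with z hz using hk z hz)
    rwa [show E.G2 i y x = 0 by rw [G2, derivWithin_of_mem_nhds hnhds, hd.deriv]]

theorem G2_nonpos {i : Fin N} {x : ℝ} (y : ℝ) : E.G2 i y x ≤ 0 :=
  (hE.antitoneOn_G i y).derivWithin_nonpos

theorem monotone_G {i : Fin N} {x : ℝ} (hx : x ∈ E.types i) : Monotone fun y => E.G i y x :=
  have := hE.g_prob i x hx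
  fun _ _ h => measureReal_mono (Iic_subset_Iic.2 h)

theorem incomeLaw_real_Ioi {i : Fin N} {x : ℝ} (hx : x ∈ E.types i) (y : ℝ) :
    (E.incomeLaw i x).real (Ioi y) = 1 - E.G i y x := by
  have := hE.g_prob i x hx
  rw [← compl_Iic, probReal_compl_eq_one_sub measurableSet_Iic, G]

theorem ae_income_nonneg {i : Fin N} {x : ℝ} (hx : x ∈ E.types i) :
    ∀ᵐ y ∂E.incomeLaw i x, 0 ≤ y :=
  (ae_mem_incomes i x).mono fun _ hy => (hE.incLo_nonneg i x hx).trans hy.1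

theorem integral_one_sub_G {i : Fin N} {x : ℝ} (hx : x ∈ E.types i) :
    ∫ y in Ioi 0, (1 - E.G i y x) = x := by
  refine Eq.trans ?_ (hE.income_mean i x hx)
  rw [(hE.income_integrable i x hx).integral_eq_integral_meas_lt (hE.ae_income_nonneg hx)]
  exact integral_congr_ae (ae_of_all _ fun y => (hE.incomeLaw_real_Ioi hx y).symm)

theorem integrableOn_one_sub_G {i : Fin N} {x : ℝ} (hx : x ∈ E.types i) :
    IntegrableOn (fun y => 1 - E.G i y x) (Ioi 0) := by
  have := hE.g_prob i x hx
  refine ⟨(measurable_const.sub (hE.monotone_G hx).measurable).aestronglyMeasurable, ?_⟩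
  have key := lintegral_eq_lintegral_meas_lt (E.incomeLaw i x) (hE.ae_income_nonneg hx)
    (hE.income_integrable i x hx).aemeasurable
  have hfin : ∫⁻ y, ENNReal.ofReal y ∂(E.incomeLaw i x) < ⊤ :=
    (lintegral_mono fun y => Real.ofReal_le_enorm y).trans_lt (hE.income_integrable i x hx).2
  rw [key] at hfin
  refine lt_of_le_of_lt (lintegral_mono fun y => ?_) hfin
  beta_reduce
  rw [← hE.incomeLaw_real_Ioi hx, Real.enorm_of_nonneg measureReal_nonneg, measureReal_def,
    ENNReal.ofReal_toReal (measure_ne_top _ _)]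
  exact le_rfl

/-- Differentiation of the normalization of types: the total sensitivity of incomes is one. -/
theorem integral_G2_Ioi {i : Fin N} {x : ℝ} (hx : x ∈ Ioo (E.tlo i) (E.thi i)) :
    ∫ y in Ioi 0, E.G2 i y x = -1 := by
  have hnhds : E.types i ∈ 𝓝 x := Icc_mem_nhds hx.1 hx.2
  have hxt : x ∈ E.types i := Ioo_subset_Icc_self hx
  obtain ⟨b, hb, hbG⟩ := hE.G_bound i
  have hder : ∀ᵐ y, HasDerivAt (fun z => E.G i y z) (E.G2 i y x) x := by
    filter_upwards [Measure.ae_ne volume (E.incLo i x),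
      Measure.ae_ne volume (E.incHi i x).toReal] with y h1 h2
    exact hE.hasDerivAt_G hx h1 fun h => h2 (by rw [← h, EReal.toReal_coe])
  -- Measurability in y comes from difference quotients along types `x + s n` decreasing to x, each
  -- a difference of functions monotone in y.
  have hmeas : AEStronglyMeasurable (fun y => E.G2 i y x) := by
    set s : ℕ → ℝ := fun n => (E.thi i - x) / ((n : ℝ) + 1)
    have hs0 : ∀ n, 0 < s n := fun n => div_pos (by linarith [hx.2]) (by positivity)
    have hslim : Tendsto s atTop (𝓝 0) := by
      have := tendsto_one_div_add_atTop_nhds_zero_nat.const_mul (E.thi i - x)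
      simpa [s, div_eq_mul_inv] using this
    have hst : ∀ n, x + s n ∈ E.types i := fun n => by
      refine ⟨by linarith [hx.1, hs0 n], ?_⟩
      have : s n ≤ E.thi i - x := div_le_self (by linarith [hx.2]) (by
        have : (0 : ℝ) ≤ n := Nat.cast_nonneg n
        linarith)
      linarith
    refine aestronglyMeasurable_of_tendsto_ae atTop
      (f := fun n y => slope (fun z => E.G i y z) x (x + s n)) (fun n => ?_) ?_
    · simp only [slope_def_field]
      exact (((hE.monotone_G (hst n)).measurable.sub
        (hE.monotone_G hxt).measurable).div_const _).aestronglyMeasurable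
    · filter_upwards [hder] with y hy
      refine (hasDerivAt_iff_tendsto_slope.1 hy).comp (tendsto_nhdsWithin_iff.2 ⟨?_, ?_⟩)
      · simpa using hslim.const_add x
      · exact Eventually.of_forall fun n => by simpa using (hs0 n).ne'
  -- The mean is the integral of `1 - G` over the positive half-line. It is differentiated under the
  -- integral, with b extended by zero outside `E.allIncomes i`, where G is constant in the type.
  have main := hasDerivAt_integral_of_dominated_loc_of_lip (μ := volume.restrict (Ioi (0 : ℝ)))
    (F := fun x y => 1 - E.G i y x) (F' := fun y => -E.G2 i y x)
    (bound := (E.allIncomes i).indicator b) hnhds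
    (by
      filter_upwards [hnhds] with z hz
      exact (measurable_const.sub (hE.monotone_G hz).measurable).aestronglyMeasurable)
    (hE.integrableOn_one_sub_G hxt) hmeas.neg.restrict ?_
    ((integrable_indicator_iff (hE.measurableSet_allIncomes i)).2 hb).restrict
    (ae_restrict_of_ae (hder.mono fun y hy => by simpa using hy.const_sub 1))
  · have h1 : HasDerivAt (fun z : ℝ => z) (∫ y in Ioi 0, -E.G2 i y x) x :=
      main.2.congr_of_eventuallyEq (by
        filter_upwards [hnhds] with z hz
        exact (hE.integral_one_sub_G hz).symm)
    have := h1.unique (hasDerivAt_id' x)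
    rw [integral_neg] at this
    linarith
  · refine ae_of_all _ fun y => LipschitzOnWith.of_dist_le_mul fun z hz z' hz' => ?_
    rw [Real.dist_eq, Real.dist_eq]
    by_cases hy : y ∈ E.allIncomes i
    · rw [indicator_of_mem hy]
      have := hbG y hy z hz z' hz'
      rw [show 1 - E.G i y z - (1 - E.G i y z') = -(E.G i y z - E.G i y z') by ring, abs_neg]
      exact this.trans (mul_le_mul_of_nonneg_right (le_abs_self _) (abs_nonneg _))
    · obtain ⟨k, hk⟩ := hE.G_const hy
      simp only [hk z hz, hk z' hz', sub_self, abs_zero]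
      positivity

/-- G2 vanishes off the open income interval, so the choice of s does not matter. It is used for the
income interval itself and for the range from 0 to the audit threshold. -/
theorem integral_G2_eq_neg_one {i : Fin N} {x : ℝ} (hx : x ∈ Ioo (E.tlo i) (E.thi i)) {s : Set ℝ}
    (hs : MeasurableSet s)
    (hs1 : ∀ y, E.incLo i x < y → (y : EReal) < E.incHi i x → y ∈ s) :
    ∫ y in s, E.G2 i y x = -1 := by
  have hlo := hE.incLo_nonneg i x (Ioo_subset_Icc_self hx)
  classical
  rw [← hE.integral_G2_Ioi hx, ← integral_indicator hs, ← integral_indicator measurableSet_Ioi]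
  congr 1
  ext y
  by_cases hy : E.incLo i x < y ∧ (y : EReal) < E.incHi i x
  · rw [indicator_of_mem (hs1 y hy.1 hy.2), indicator_of_mem (mem_Ioi.2 (hlo.trans_lt hy.1))]
  · have : E.G2 i y x = 0 := hE.G2_eq_zero hx (by
      by_contra! hc
      exact hy hc)
    rw [indicator_apply, indicator_apply, this, ite_self, ite_self]

end Standing

/-! ### Type distributions -/

theorem ae_mem_Ioo_types (i : Fin N) : ∀ᵐ x ∂E.typeLaw i, x ∈ Ioo (E.tlo i) (E.thi i) := by
  have h : ∀ᵐ x ∂E.typeLaw i, x ∈ E.types i :=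
    (withDensity_absolutelyContinuous _ _).ae_le (ae_restrict_mem measurableSet_Icc)
  filter_upwards [h, Measure.ae_ne (E.typeLaw i) (E.tlo i), Measure.ae_ne (E.typeLaw i) (E.thi i)]
    with x hx h1 h2
  exact ⟨lt_of_le_of_ne hx.1 h1.symm, lt_of_le_of_ne hx.2 h2⟩

theorem ae_mem_types (i : Fin N) : ∀ᵐ x ∂E.typeLaw i, x ∈ E.types i :=
  (ae_mem_Ioo_types i).mono fun _ hx => Ioo_subset_Icc_self hx

theorem measurableSet_profiles : MeasurableSet E.profiles := by
  have : E.profiles = univ.pi E.types := by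
    ext θ
    simp [profiles]
  rw [this]
  exact MeasurableSet.univ_pi fun i => measurableSet_Icc

theorem update_mem_profiles {i : Fin N} {θ : Fin N → ℝ} {x : ℝ} (hθ : θ ∈ E.profiles)
    (hx : x ∈ E.types i) : Function.update θ i x ∈ E.profiles := by
  intro j
  by_cases hj : j = i
  · subst hj
    simpa using hx
  · simpa [hj] using hθ j

/-- The inverse hazard rate of the type distribution. -/
noncomputable def hazard (E : Primitives N) (i : Fin N) (x : ℝ) : ℝ := (1 - E.F i x) / E.f i x

namespace Standing

variable (hE : E.Standing)

include hE

theorem ae_profile_Ioo : ∀ᵐ θ ∂E.profileLaw, ∀ i, θ i ∈ Ioo (E.tlo i) (E.thi i) := by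
  have := hE.f_prob
  exact eventually_all.2 fun i =>
    (Measure.tendsto_eval_ae_ae (μ := E.typeLaw) (i := i)).eventually (ae_mem_Ioo_types i)

theorem ae_mem_profiles : ∀ᵐ θ ∂E.profileLaw, θ ∈ E.profiles :=
  hE.ae_profile_Ioo.mono fun _ hθ i => Ioo_subset_Icc_self (hθ i)

theorem isProbabilityMeasure_profileLaw : IsProbabilityMeasure E.profileLaw := by
  have := hE.f_prob
  unfold profileLaw
  infer_instance

theorem lo_le_hi (i : Fin N) : E.tlo i ≤ E.thi i := (hE.types_nondeg i).le

theorem f_nonneg {i : Fin N} {x : ℝ} (hx : x ∈ E.types i) : 0 ≤ E.f i x := by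
  have hcl : closure (Ioo (E.tlo i) (E.thi i)) = E.types i := closure_Ioo (hE.types_nondeg i).ne
  exact le_on_closure (f := fun _ => (0 : ℝ)) (fun z hz => (hE.f_pos i z hz).le) continuousOn_const
    (by rw [hcl]; exact hE.f_cont i) (by rwa [hcl])

theorem aemeasurable_f (i : Fin N) :
    AEMeasurable (fun x => ENNReal.ofReal (E.f i x)) (volume.restrict (E.types i)) :=
  ((hE.f_cont i).aemeasurable measurableSet_Icc).ennreal_ofReal

theorem integral_typeLaw (i : Fin N) (h : ℝ → ℝ) :
    ∫ x, h x ∂E.typeLaw i = ∫ x in (E.tlo i)..(E.thi i), E.f i x * h x := by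
  rw [typeLaw, integral_withDensity_eq_integral_toReal_smul₀ (hE.aemeasurable_f i)
    (ae_of_all _ fun x => ENNReal.ofReal_lt_top), intervalIntegral.integral_of_le (hE.lo_le_hi i),
    ← integral_Icc_eq_integral_Ioc]
  refine setIntegral_congr_fun measurableSet_Icc fun x hx => ?_
  simp only [ENNReal.toReal_ofReal (hE.f_nonneg hx), smul_eq_mul]

theorem integrable_typeLaw_iff (i : Fin N) (h : ℝ → ℝ) :
    Integrable h (E.typeLaw i) ↔ IntegrableOn (fun x => E.f i x * h x) (E.types i) := by
  rw [typeLaw, integrable_withDensity_iff_integrable_smul₀' (hE.aemeasurable_f i)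
    (ae_of_all _ fun x => ENNReal.ofReal_lt_top)]
  refine integrable_congr ?_
  filter_upwards [ae_restrict_mem measurableSet_Icc] with x hx
  simp only [ENNReal.toReal_ofReal (hE.f_nonneg hx), smul_eq_mul]

theorem F_le_one (i : Fin N) (x : ℝ) : E.F i x ≤ 1 :=
  have := hE.f_prob i
  measureReal_le_one

theorem hazard_nonneg {i : Fin N} {x : ℝ} (hx : x ∈ E.types i) : 0 ≤ E.hazard i x :=
  div_nonneg (sub_nonneg.2 (hE.F_le_one i x)) (hE.f_nonneg hx)

theorem f_mul_hazard {i : Fin N} {x : ℝ} (hx : x ∈ Ioo (E.tlo i) (E.thi i)) :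
    E.f i x * E.hazard i x = 1 - E.F i x :=
  mul_div_cancel₀ _ (hE.f_pos i x hx).ne'

/-! ### The mechanism with capped royalties under free auditing -/

theorem μ_mul_φ_nonneg {i : Fin N} {x y : ℝ} (hx : x ∈ E.types i) (h1 : E.incLo i x < y)
    (h2 : (y : EReal) < E.incHi i x) : 0 ≤ E.μ i x y * E.φ i := by
  refine mul_nonneg (mul_nonneg ?_ (hE.hazard_nonneg hx)) (hE.φ_mem i).1
  exact neg_nonneg.2 (div_nonpos_of_nonpos_of_nonneg (hE.G2_nonpos y) (hE.g_pos i x hx y h1 h2).le)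

/-- The income density cancels the denominator of μ and leaves a multiple of the integral of G2. -/
theorem integral_μ {i : Fin N} {x : ℝ} (hx : x ∈ Ioo (E.tlo i) (E.thi i)) :
    ∫ y, max (E.μ i x y * E.φ i) 0 ∂E.incomeLaw i x = E.φ i * E.hazard i x := by
  have hxt : x ∈ E.types i := Ioo_subset_Icc_self hx
  rw [incomeLaw, integral_withDensity_eq_integral_toReal_smul₀ (hE.aemeasurable_g hxt)
    (ae_of_all _ fun x => ENNReal.ofReal_lt_top)]
  have : ∀ᵐ y ∂volume.restrict (E.incomes i x),
      (ENNReal.ofReal (E.g i x y)).toReal • max (E.μ i x y * E.φ i) 0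
        = -(E.φ i * E.hazard i x) * E.G2 i y x := by
    filter_upwards [ae_mem_interior_incomes i x] with y hy
    have hg := hE.g_pos i x hxt y hy.1 hy.2
    rw [max_eq_left (hE.μ_mul_φ_nonneg hxt hy.1 hy.2), ENNReal.toReal_ofReal hg.le, smul_eq_mul, μ,
      ← hazard]
    field_simp
  rw [integral_congr_ae this, integral_const_mul,
    hE.integral_G2_eq_neg_one hx (measurableSet_incomes i x) fun y h1 h2 => ⟨h1.le, h2.le⟩]
  ring

theorem psi_eq_psi0 (hc : ∀ i, E.c i = 0) : E.psi = E.psi0 := by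
  have key : ∀ i, ∀ x ∈ Ioo (E.tlo i) (E.thi i), E.psiFormula i x = E.psi0Formula i x := by
    intro i x hx
    simp only [psiFormula, psi0Formula, hc i, sub_zero, hE.integral_μ hx]
    rw [← hazard]
    ring
  ext i x
  simp only [psi, psi0, extend]
  split_ifs with hx
  · rw [key i x hx]
  · refine liminf_congr ?_
    filter_upwards [self_mem_nhdsWithin] with z hz
    rw [key i z hz]

/-- With zero cost every interior income meets the audit criterion. The supremum is approached from
the interior, because the sign of μ is not controlled at the end points. -/
theorem threshold_eq_incHi (hc : ∀ i, E.c i = 0) {i : Fin N} {x : ℝ} (hx : x ∈ E.types i) :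
    E.threshold i x = E.incHi i x := by
  have hpos : (0 : EReal) ≤ E.incHi i x := by
    refine le_trans ?_ (hE.incLo_lt_incHi i x hx).le
    exact_mod_cast hE.incLo_nonneg i x hx
  have hsup : sSup ((fun y : ℝ => (y : EReal)) '' {y ∈ E.incomes i x | E.c i ≤ E.μ i x y * E.φ i})
      = E.incHi i x := by
    refine le_antisymm (sSup_le ?_) (le_of_forall_lt fun a ha => ?_)
    · rintro _ ⟨y, hy, rfl⟩
      exact hy.1.2
    · obtain ⟨m, hm1, hm2⟩ := EReal.lt_iff_exists_real_btwn.1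
        (max_lt ha (hE.incLo_lt_incHi i x hx))
      rw [max_lt_iff, EReal.coe_lt_coe_iff] at hm1
      refine hm1.1.trans_le (le_sSup ⟨m, ⟨⟨hm1.2.le, hm2.le⟩, ?_⟩, rfl⟩)
      rw [hc i]
      exact hE.μ_mul_φ_nonneg hx hm1.2 hm2
  rw [threshold, hsup, max_eq_right hpos]

theorem Phi_eq_φ (hc : ∀ i, E.c i = 0) {i : Fin N} {x : ℝ} (hx : x ∈ Ioo (E.tlo i) (E.thi i)) :
    E.Phi i x = E.φ i := by
  have hxt : x ∈ E.types i := Ioo_subset_Icc_self hx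
  rw [Phi, hE.threshold_eq_incHi hc hxt, hE.integral_G2_eq_neg_one hx]
  · ring
  · exact measurableSet_Ici.inter (measurable_coe_real_ereal measurableSet_Iic)
  · exact fun y h1 h2 => ⟨(hE.incLo_nonneg i x hxt).trans h1.le, h2.le⟩

theorem cappedRoyalty_eq (hc : ∀ i, E.c i = 0) {i : Fin N} {θ : Fin N → ℝ} (hθ : θ i ∈ E.types i)
    {y : ℝ} (hy : y ∈ E.incomes i (θ i)) : E.cappedRoyalty i θ y = y * E.φ i := by
  rw [cappedRoyalty, hE.threshold_eq_incHi hc hθ, min_eq_left hy.2, EReal.toReal_coe]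

theorem cappedMechanism_t_eq (hc : ∀ i, E.c i = 0) (i : Fin N) {θ : Fin N → ℝ}
    (hθ : θ ∈ E.profiles) : E.cappedMechanism.t i θ = E.freeMechanism.t i θ := by
  have h1 : ∫ y, (y - E.cappedRoyalty i θ y) ∂E.incomeLaw i (θ i) = (1 - E.φ i) * θ i := by
    have : ∀ᵐ y ∂E.incomeLaw i (θ i), y - E.cappedRoyalty i θ y = (1 - E.φ i) * y := by
      filter_upwards [ae_mem_incomes i (θ i)] with y hy
      rw [hE.cappedRoyalty_eq hc (hθ i) hy]
      ring
    rw [integral_congr_ae this, integral_const_mul, hE.income_mean i _ (hθ i)]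
  have h2 : ∫ z in (E.tlo i)..(θ i),
        allocate E.psi0 i (Function.update θ i z) * (1 - E.Phi i z)
      = (1 - E.φ i) * ∫ z in (E.tlo i)..(θ i), allocate E.psi0 i (Function.update θ i z) := by
    -- `Phi` is known only at interior types, hence the passage to the open interval.
    rw [← intervalIntegral.integral_const_mul, intervalIntegral.integral_of_le (hθ i).1,
      intervalIntegral.integral_of_le (hθ i).1, integral_Ioc_eq_integral_Ioo,
      integral_Ioc_eq_integral_Ioo]
    refine setIntegral_congr_fun measurableSet_Ioo fun z hz => ?_
    simp only [hE.Phi_eq_φ hc ⟨hz.1, hz.2.trans_le (hθ i).2⟩]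
    ring
  simp only [cappedMechanism, freeMechanism, hE.psi_eq_psi0 hc, h1, h2]
  ring

theorem cappedMechanism_a_eq (hc : ∀ i, E.c i = 0) (i : Fin N) {θ : Fin N → ℝ}
    (hθ : θ ∈ E.profiles) {y : ℝ} (hy : y ∈ E.incomes i (θ i))
    (hy' : (y : EReal) ≠ E.incHi i (θ i)) :
    E.cappedMechanism.a i θ y = E.freeMechanism.a i θ y := by
  simp only [cappedMechanism, freeMechanism, hE.threshold_eq_incHi hc (hθ i)]
  exact if_pos (lt_of_le_of_ne hy.2 hy')

end Standing

/-! ### Free-auditing virtual values -/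

/-- The point of `Θ_i` closest to `x`. -/
def clampType (E : Primitives N) (i : Fin N) (x : ℝ) : ℝ := max (E.tlo i) (min (E.thi i) x)

theorem monotone_clampType (i : Fin N) : Monotone (E.clampType i) := fun _ _ h =>
  max_le_max le_rfl (min_le_min le_rfl h)

theorem clampType_of_mem {i : Fin N} {x : ℝ} (hx : x ∈ E.types i) : E.clampType i x = x := by
  rw [clampType, min_eq_right hx.2, max_eq_right hx.1]

theorem measurable_clampType (i : Fin N) : Measurable (E.clampType i) :=
  (monotone_clampType i).measurable

theorem Standing.clampType_mem (hE : E.Standing) (i : Fin N) (x : ℝ) :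
    E.clampType i x ∈ E.types i :=
  ⟨le_max_left _ _, max_le (hE.lo_le_hi i) (min_le_left _ _)⟩

theorem psi0_of_mem {i : Fin N} {x : ℝ} (hx : x ∈ Ioo (E.tlo i) (E.thi i)) :
    E.psi0 i x = (E.psi0Formula i x : EReal) := by
  rw [psi0, extend, if_pos hx]

section VirtualValues

variable {i : Fin N} (hψ : StrictMonoOn (E.psi0Formula i) (Ioo (E.tlo i) (E.thi i)))

include hψ

/-- At the lower extreme type the virtual value is a lower limit, which preserves only weak
inequalities; an intermediate type restores strictness. -/
theorem psi0_lt_coe {x m : ℝ} (hx : x ∈ E.types i) (hm : m ∈ Ioo (E.tlo i) (E.thi i))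
    (hxm : x < m) : E.psi0 i x < (E.psi0Formula i m : EReal) := by
  rcases hx.1.eq_or_lt with h | h
  · obtain ⟨m', h1, h2⟩ := exists_between hxm
    have hm' : m' ∈ Ioo (E.tlo i) (E.thi i) := ⟨h.trans_lt h1, h2.trans hm.2⟩
    refine lt_of_le_of_lt ?_ (EReal.coe_lt_coe_iff.2 (hψ hm' hm h2))
    rw [psi0, extend, if_neg (by rw [← h]; simp), ← h]
    have hne : (𝓝[Ioo (E.tlo i) (E.thi i)] E.tlo i).NeBot := by
      rw [← mem_closure_iff_nhdsWithin_neBot, closure_Ioo (hm.1.trans hm.2).ne]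
      exact left_mem_Icc.2 (hm.1.trans hm.2).le
    refine liminf_le_of_frequently_le' (Eventually.frequently ?_)
    filter_upwards [self_mem_nhdsWithin, mem_nhdsWithin_of_mem_nhds (Iio_mem_nhds hm'.1)]
      with z hz1 hz2
    exact EReal.coe_le_coe_iff.2 (hψ hz1 hm' hz2).le
  · have hx' : x ∈ Ioo (E.tlo i) (E.thi i) := ⟨h, hxm.trans hm.2⟩
    rw [psi0_of_mem hx']
    exact EReal.coe_lt_coe_iff.2 (hψ hx' hm hxm)

theorem coe_lt_psi0 {x m : ℝ} (hx : x ∈ E.types i) (hm : m ∈ Ioo (E.tlo i) (E.thi i))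
    (hmx : m < x) : (E.psi0Formula i m : EReal) < E.psi0 i x := by
  rcases hx.2.eq_or_lt with h | h
  · obtain ⟨m', h1, h2⟩ := exists_between hmx
    have hm' : m' ∈ Ioo (E.tlo i) (E.thi i) := ⟨hm.1.trans h1, h2.trans_eq h⟩
    refine lt_of_lt_of_le (EReal.coe_lt_coe_iff.2 (hψ hm hm' h1)) ?_
    rw [psi0, extend, if_neg (by rw [h]; simp), h]
    refine le_liminf_of_le (by isBoundedDefault) ?_
    filter_upwards [self_mem_nhdsWithin, mem_nhdsWithin_of_mem_nhds (Ioi_mem_nhds hm'.2)]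
      with z hz1 hz2
    exact EReal.coe_le_coe_iff.2 (hψ hm' hz1 hz2).le
  · have hx' : x ∈ Ioo (E.tlo i) (E.thi i) := ⟨hm.1.trans hmx, h⟩
    rw [psi0_of_mem hx']
    exact EReal.coe_lt_coe_iff.2 (hψ hm hx' hmx)

theorem strictMonoOn_psi0 : StrictMonoOn (E.psi0 i) (E.types i) := by
  intro x hx y hy hxy
  obtain ⟨m, h1, h2⟩ := exists_between hxy
  have hm : m ∈ Ioo (E.tlo i) (E.thi i) := ⟨hx.1.trans_lt h1, h2.trans_le hy.2⟩
  exact (psi0_lt_coe hψ hx hm h1).trans (coe_lt_psi0 hψ hy hm h2)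

theorem measurable_psi0 (hE : E.Standing) : Measurable (E.psi0 i) := by
  classical
  -- Outside the closed type interval the filter is `⊥` and its `liminf` is `⊤`. Inside, clamping
  -- turns `psi0` into a function monotone on the whole line.
  have : E.psi0 i = fun x => if x ∈ E.types i then E.psi0 i (E.clampType i x) else ⊤ := by
    ext x
    split_ifs with hx
    · rw [clampType_of_mem hx]
    · rw [psi0, extend, if_neg fun h => hx (Ioo_subset_Icc_self h)]
      have : 𝓝[Ioo (E.tlo i) (E.thi i)] x = ⊥ := by
        rwa [← not_neBot, ← mem_closure_iff_nhdsWithin_neBot, closure_Ioo (hE.types_nondeg i).ne]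
      rw [this, liminf_bot]
  rw [this]
  refine Measurable.ite measurableSet_Icc ?_ measurable_const
  refine Monotone.measurable fun x y h => ?_
  exact (strictMonoOn_psi0 hψ).monotoneOn (hE.clampType_mem i x) (hE.clampType_mem i y)
    (monotone_clampType i h)

end VirtualValues

/-! ### The allocation rule -/

theorem allocate_mem (v : Fin N → ℝ → EReal) (i : Fin N) (θ : Fin N → ℝ) :
    allocate v i θ ∈ Icc (0 : ℝ) 1 := by
  rw [allocate]
  split_ifs <;> simp

theorem allocate_eq_zero_of_ne {v : Fin N → ℝ → EReal} {i j : Fin N} {θ : Fin N → ℝ}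
    (hi : 0 < v i (θ i) ∧ ∀ j, j ≠ i → v j (θ j) < v i (θ i)) (hj : j ≠ i) :
    allocate v j θ = 0 :=
  if_neg fun h => absurd (h.2 i hj.symm) (hi.2 j hj).not_gt

theorem sum_allocate_le_one (v : Fin N → ℝ → EReal) (θ : Fin N → ℝ) :
    ∑ i, allocate v i θ ≤ 1 := by
  by_cases h : ∃ i, 0 < v i (θ i) ∧ ∀ j, j ≠ i → v j (θ j) < v i (θ i)
  · obtain ⟨i, hi⟩ := h
    rw [Finset.sum_eq_single i (fun j _ hj => allocate_eq_zero_of_ne hi hj) (by simp)]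
    exact (allocate_mem v i θ).2
  · have h0 : ∀ i, allocate v i θ = 0 := fun i => if_neg fun hi => h ⟨i, hi⟩
    simp [h0]

theorem measurable_allocate {v : Fin N → ℝ → EReal} (hv : ∀ i, Measurable (v i)) (i : Fin N) :
    Measurable (allocate v i) := by
  classical
  have hm : ∀ j, Measurable fun θ : Fin N → ℝ => v j (θ j) := fun j =>
    (hv j).comp (measurable_pi_apply j)
  have : {θ : Fin N → ℝ | ∀ j, j ≠ i → v j (θ j) < v i (θ i)}
      = ⋂ j, ⋂ (_ : j ≠ i), {θ | v j (θ j) < v i (θ i)} := by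
    ext θ
    simp
  have hall : MeasurableSet {θ : Fin N → ℝ | ∀ j, j ≠ i → v j (θ j) < v i (θ i)} := by
    rw [this]
    exact MeasurableSet.iInter fun j => MeasurableSet.iInter fun _ => measurableSet_lt (hm j) (hm i)
  exact Measurable.ite ((measurableSet_lt measurable_const (hm i)).inter hall) measurable_const
    measurable_const

theorem monotoneOn_allocate_update {v : Fin N → ℝ → EReal} {i : Fin N} {s : Set ℝ}
    (hv : MonotoneOn (v i) s) (θ : Fin N → ℝ) :
    MonotoneOn (fun x => allocate v i (Function.update θ i x)) s := by
  intro x hx x' hx' h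
  by_cases hw : 0 < v i x ∧ ∀ j, j ≠ i → v j (θ j) < v i x
  · have e : allocate v i (Function.update θ i x') = 1 := by
      refine if_pos ⟨?_, fun j hj => ?_⟩
      · simpa using hw.1.trans_le (hv hx hx' h)
      · simpa [hj] using (hw.2 j hj).trans_le (hv hx hx' h)
    simp only [e]
    exact (allocate_mem v i _).2
  · have e : allocate v i (Function.update θ i x) = 0 := by
      refine if_neg fun hc => hw ⟨by simpa using hc.1, fun j hj => ?_⟩
      simpa [hj] using hc.2 j hj
    simp only [e]
    exact (allocate_mem v i _).1

/-- Without ties, allocating to the highest positive value maximizes the expected value. -/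
theorem sum_mul_le_sum_allocate_mul {v : Fin N → ℝ → EReal} {θ : Fin N → ℝ} {w q : Fin N → ℝ}
    (hw : ∀ i, v i (θ i) = (w i : EReal)) (hinj : ∀ i j, i ≠ j → w i ≠ w j)
    (hq0 : ∀ i, 0 ≤ q i) (hq1 : ∑ i, q i ≤ 1) :
    ∑ i, q i * w i ≤ ∑ i, allocate v i θ * w i := by
  have hnn : ∀ i, 0 ≤ allocate v i θ * w i := by
    intro i
    rw [allocate]
    split_ifs with h
    · rw [hw i] at h
      simpa using (EReal.coe_pos.1 h.1).le
    · simp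
  by_cases hpos : ∃ i, 0 < w i
  · obtain ⟨i₀, hi₀⟩ := hpos
    obtain ⟨i, -, hi⟩ := Finset.exists_max_image Finset.univ w ⟨i₀, Finset.mem_univ _⟩
    have hwi : 0 < w i := hi₀.trans_le (hi i₀ (Finset.mem_univ _))
    have hal : allocate v i θ = 1 := if_pos ⟨by rw [hw i]; exact EReal.coe_pos.2 hwi,
      fun j hj => by
        rw [hw i, hw j, EReal.coe_lt_coe_iff]
        exact lt_of_le_of_ne (hi j (Finset.mem_univ _)) (hinj j i hj)⟩
    calc ∑ j, q j * w j ≤ ∑ j, q j * w i :=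
          Finset.sum_le_sum fun j _ => mul_le_mul_of_nonneg_left (hi j (Finset.mem_univ _)) (hq0 j)
      _ = (∑ j, q j) * w i := by rw [Finset.sum_mul]
      _ ≤ 1 * w i := mul_le_mul_of_nonneg_right hq1 hwi.le
      _ = allocate v i θ * w i := by rw [hal]
      _ ≤ ∑ j, allocate v j θ * w j :=
          Finset.single_le_sum (f := fun j => allocate v j θ * w j) (fun j _ => hnn j)
            (Finset.mem_univ i)
  · push Not at hpos
    exact (Finset.sum_nonpos fun j _ => mul_nonpos_of_nonneg_of_nonpos (hq0 j) (hpos j)).trans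
      (Finset.sum_nonneg fun j _ => hnn j)

theorem measurable_update_pair (i : Fin N) :
    Measurable fun k : (Fin N → ℝ) × ℝ => Function.update k.1 i k.2 := by
  refine measurable_pi_lambda _ fun j => ?_
  by_cases hj : j = i
  · subst hj
    simpa using measurable_snd
  · simp only [Function.update_of_ne hj]
    exact (measurable_pi_apply j).comp measurable_fst

theorem measurable_update_const (i : Fin N) (x : ℝ) :
    Measurable fun θ : Fin N → ℝ => Function.update θ i x :=
  (measurable_update_pair i).comp (measurable_id.prodMk measurable_const)

/-- The payment of agent `i` after the income stage, when he reports his income `y` truthfully. -/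
def pay (M : Mechanism N) (i : Fin N) (θ : Fin N → ℝ) (y : ℝ) : ℝ :=
  M.q i θ * (M.r i θ y + M.a i θ y * M.p i θ y y)

namespace Standing

variable (hE : E.Standing)

include hE

/-! ### Interim expectations -/

theorem measurePreserving_update_profileLaw (i : Fin N) :
    MeasurePreserving (fun k : (Fin N → ℝ) × ℝ => Function.update k.1 i k.2)
      (E.profileLaw.prod (E.typeLaw i)) E.profileLaw := by
  have := hE.f_prob
  exact measurePreserving_update E.typeLaw i

theorem integrable_interim (i : Fin N) {h : (Fin N → ℝ) → ℝ} (hh : Integrable h E.profileLaw) :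
    Integrable (fun x => E.interim i x h) (E.typeLaw i) := by
  have := hE.f_prob
  have := hE.isProbabilityMeasure_profileLaw
  exact (((hE.measurePreserving_update_profileLaw i).integrable_comp
    hh.aestronglyMeasurable).2 hh).integral_prod_right

theorem integral_interim (i : Fin N) {h : (Fin N → ℝ) → ℝ} (hh : Integrable h E.profileLaw) :
    ∫ x, E.interim i x h ∂E.typeLaw i = ∫ θ, h θ ∂E.profileLaw := by
  have := hE.f_prob
  have := hE.isProbabilityMeasure_profileLaw
  have mp := hE.measurePreserving_update_profileLaw i
  conv_rhs => rw [← mp.map_eq]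
  rw [integral_map mp.measurable.aemeasurable (by rw [mp.map_eq]; exact hh.aestronglyMeasurable)]
  exact (integral_prod_symm _ ((mp.integrable_comp hh.aestronglyMeasurable).2 hh)).symm

theorem ae_update_mem_profiles {i : Fin N} {x : ℝ} (hx : x ∈ E.types i) :
    ∀ᵐ θ ∂E.profileLaw, Function.update θ i x ∈ E.profiles :=
  hE.ae_mem_profiles.mono fun _ hθ => update_mem_profiles hθ hx

theorem interim_congr {i : Fin N} {x : ℝ} (hx : x ∈ E.types i) {h k : (Fin N → ℝ) → ℝ}
    (hk : ∀ θ ∈ E.profiles, h θ = k θ) : E.interim i x h = E.interim i x k :=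
  integral_congr_ae ((hE.ae_update_mem_profiles hx).mono fun _ hθ => hk _ hθ)

/-- A rule that is measurable and takes its values in `[0, 1]` on the type profiles. -/
theorem integrable_of_mem_Icc {h : (Fin N → ℝ) → ℝ} (hm : Measurable (E.profiles.domRestrict h))
    (h01 : ∀ θ ∈ E.profiles, h θ ∈ Icc (0 : ℝ) 1) : Integrable h E.profileLaw := by
  have := hE.isProbabilityMeasure_profileLaw
  have hmi := measurable_indicator_of_domRestrict measurableSet_profiles hm
  refine Integrable.of_bound (C := 1) (hmi.aestronglyMeasurable.congr ?_) ?_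
  · filter_upwards [hE.ae_mem_profiles] with θ hθ using indicator_of_mem hθ h
  · filter_upwards [hE.ae_mem_profiles] with θ hθ
    rw [Real.norm_eq_abs, abs_of_nonneg (h01 θ hθ).1]
    exact (h01 θ hθ).2

theorem integrable_update_of_mem_Icc {h : (Fin N → ℝ) → ℝ}
    (hm : Measurable (E.profiles.domRestrict h)) (h01 : ∀ θ ∈ E.profiles, h θ ∈ Icc (0 : ℝ) 1)
    {i : Fin N} {x : ℝ} (hx : x ∈ E.types i) :
    Integrable (fun θ => h (Function.update θ i x)) E.profileLaw := by
  have := hE.isProbabilityMeasure_profileLaw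
  have hmi := measurable_indicator_of_domRestrict measurableSet_profiles hm
  refine Integrable.of_bound (C := 1)
    ((hmi.comp (measurable_update_const i x)).aestronglyMeasurable.congr ?_) ?_
  · filter_upwards [hE.ae_update_mem_profiles hx] with θ hθ using indicator_of_mem hθ h
  · filter_upwards [hE.ae_update_mem_profiles hx] with θ hθ
    rw [Real.norm_eq_abs, abs_of_nonneg (h01 _ hθ).1]
    exact (h01 _ hθ).2

theorem interim_mem_Icc {h : (Fin N → ℝ) → ℝ} (hm : Measurable (E.profiles.domRestrict h))
    (h01 : ∀ θ ∈ E.profiles, h θ ∈ Icc (0 : ℝ) 1) {i : Fin N} {x : ℝ} (hx : x ∈ E.types i) :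
    E.interim i x h ∈ Icc (0 : ℝ) 1 := by
  have := hE.isProbabilityMeasure_profileLaw
  have hae := hE.ae_update_mem_profiles hx
  constructor
  · exact integral_nonneg_of_ae (hae.mono fun θ hθ => (h01 _ hθ).1)
  · have := integral_mono_ae (hE.integrable_update_of_mem_Icc hm h01 hx)
      (integrable_const (1 : ℝ)) (hae.mono fun θ hθ => (h01 _ hθ).2)
    simpa [interim] using this

/-- Interim expectations depend measurably on the type. -/
theorem exists_measurable_interim {h : (Fin N → ℝ) → ℝ}
    (hm : Measurable (E.profiles.domRestrict h)) (h01 : ∀ θ ∈ E.profiles, h θ ∈ Icc (0 : ℝ) 1)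
    (i : Fin N) :
    ∃ k : ℝ → ℝ, Measurable k ∧ (∀ x, k x ∈ Icc (0 : ℝ) 1) ∧
      ∀ x ∈ E.types i, E.interim i x h = k x := by
  have := hE.isProbabilityMeasure_profileLaw
  have hmi := measurable_indicator_of_domRestrict measurableSet_profiles hm
  refine ⟨fun x => E.interim i (E.clampType i x) h, ?_,
    fun x => hE.interim_mem_Icc hm h01 (hE.clampType_mem i x), fun x hx => by
      simp only [clampType_of_mem hx]⟩
  have e : (fun x => E.interim i (E.clampType i x) h)
      = fun x => E.interim i (E.clampType i x) (E.profiles.indicator h) := by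
    ext x
    exact hE.interim_congr (hE.clampType_mem i x) fun θ hθ => (indicator_of_mem hθ h).symm
  rw [e]
  refine (StronglyMeasurable.integral_prod_left (μ := E.profileLaw)
    (f := fun θ x => E.profiles.indicator h (Function.update θ i (E.clampType i x))) ?_).measurable
  exact (hmi.comp ((measurable_update_pair i).comp
    (measurable_fst.prodMk ((measurable_clampType i).comp measurable_snd)))).stronglyMeasurable

/-! ### Incomes as a kernel -/

/-- The assumptions contain no measurability in the type. Stochastic dominance supplies it: the mass
of each half-line is monotone in the type, and half-lines generate the Borel sets. Clamping makes
every value a probability measure. -/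
theorem measurable_incomeLaw (i : Fin N) :
    Measurable fun θ : Fin N → ℝ => E.incomeLaw i (E.clampType i (θ i)) := by
  have hprob : ∀ x, IsProbabilityMeasure (E.incomeLaw i (E.clampType i x)) := fun x =>
    hE.g_prob i _ (hE.clampType_mem i x)
  refine Measurable.measure_of_isPiSystem_of_isProbabilityMeasure
    (borel_eq_generateFrom_Iic ℝ ▸ BorelSpace.measurable_eq) isPiSystem_Iic ?_
  rintro _ ⟨y, rfl⟩
  have hanti : Antitone fun x => E.incomeLaw i (E.clampType i x) (Iic y) := by
    intro x x' h
    have := hE.antitoneOn_G i y (hE.clampType_mem i x) (hE.clampType_mem i x')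
      (monotone_clampType i h)
    exact (ENNReal.toReal_le_toReal (measure_ne_top _ _) (measure_ne_top _ _)).1 this
  exact hanti.measurable.comp (measurable_pi_apply i)

theorem measurableSet_histories (i : Fin N) : MeasurableSet (E.histories i) := by
  have hclamp : Measurable fun h : (Fin N → ℝ) × ℝ => h.1 i :=
    (measurable_pi_apply i).comp measurable_fst
  have hlo : Measurable fun h : (Fin N → ℝ) × ℝ => E.incLo i (E.clampType i (h.1 i)) :=
    Monotone.measurable (f := fun x => E.incLo i (E.clampType i x)) (fun x x' h =>
      hE.monotoneOn_incLo i (hE.clampType_mem i x) (hE.clampType_mem i x')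
        (monotone_clampType i h)) |>.comp hclamp
  have hhi : Measurable fun h : (Fin N → ℝ) × ℝ => E.incHi i (E.clampType i (h.1 i)) :=
    Monotone.measurable (f := fun x => E.incHi i (E.clampType i x)) (fun x x' h =>
      hE.monotoneOn_incHi i (hE.clampType_mem i x) (hE.clampType_mem i x')
        (monotone_clampType i h)) |>.comp hclamp
  have : E.histories i = (Prod.fst ⁻¹' E.profiles) ∩
      ({h | E.incLo i (E.clampType i (h.1 i)) ≤ h.2} ∩
        {h | (h.2 : EReal) ≤ E.incHi i (E.clampType i (h.1 i))}) := by
    ext h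
    constructor
    · rintro ⟨h1, h2⟩
      refine ⟨h1, ?_⟩
      simp only [mem_inter_iff, mem_ofPred_eq, clampType_of_mem (h1 i)]
      exact h2
    · rintro ⟨h1, h2⟩
      refine ⟨h1, ?_⟩
      simp only [mem_inter_iff, mem_ofPred_eq, clampType_of_mem (h1 i)] at h2
      exact h2
  rw [this]
  exact (measurable_fst measurableSet_profiles).inter ((measurableSet_le hlo measurable_snd).inter
    (measurableSet_le (measurable_coe_real_ereal.comp measurable_snd) hhi))

end Standing

/-! ### Utilities and revenue of an arbitrary mechanism. -/

namespace IsMechanism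

variable {M : Mechanism N} (hE : E.Standing) (hM : E.IsMechanism M)

include hM

theorem q_mem_Icc (i : Fin N) : ∀ θ ∈ E.profiles, M.q i θ ∈ Icc (0 : ℝ) 1 := fun θ hθ =>
  ⟨hM.q_nonneg i θ hθ, (Finset.single_le_sum (f := fun j => M.q j θ)
    (fun j _ => hM.q_nonneg j θ hθ) (Finset.mem_univ i)).trans (hM.q_sum θ hθ)⟩

theorem u_eq {i : Fin N} {x y' y : ℝ} (hx : x ∈ E.types i) (hy' : y' ∈ E.incomes i x)
    (hy : y ∈ E.allIncomes i) (hE : E.Standing) :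
    E.u M i x y' y = E.interim i x (M.q i) * y
      - E.interim i x (fun θ => M.q i θ * (M.r i θ y' + M.a i θ y' * M.p i θ y' y)) := by
  rw [u, interim, interim, interim, ← integral_mul_const, ← integral_sub
    ((hE.integrable_update_of_mem_Icc (hM.q_meas i) (hM.q_mem_Icc i) hx).mul_const y)
    (hM.pay_interim i x hx y' hy' y hy)]
  congr 1
  ext θ
  ring

theorem measurable_pay (i : Fin N) :
    Measurable ((E.histories i).domRestrict fun h => pay M i h.1 h.2) := by
  have hq : Measurable fun h : E.histories i => M.q i h.1.1 :=
    (hM.q_meas i).comp (f := fun h : E.histories i => (⟨h.1.1, h.2.1⟩ : E.profiles))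
      (measurable_fst.comp measurable_subtype_coe).subtype_mk
  have hp : Measurable fun h : E.histories i => M.p i h.1.1 h.1.2 h.1.2 :=
    (hM.p_meas i).comp (f := fun h : E.histories i =>
        (⟨(h.1, h.1.2), h.2, incomes_subset_allIncomes (h.2.1 i) h.2.2⟩ :
          ((E.histories i) ×ˢ (E.allIncomes i) : Set (((Fin N → ℝ) × ℝ) × ℝ))))
      (measurable_subtype_coe.prodMk (measurable_snd.comp measurable_subtype_coe)).subtype_mk
  exact hq.mul ((hM.r_meas i).add ((hM.a_meas i).mul hp))

include hE

/-- The payments after the income stage are integrable, and their expectation can be computed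
type by type. -/
theorem interim_expected_pay (i : Fin N) :
    Integrable (fun θ => ∫ y, pay M i θ y ∂E.incomeLaw i (θ i)) E.profileLaw ∧
    ∀ᵐ x ∂E.typeLaw i,
      E.interim i x (fun θ => ∫ y, pay M i θ y ∂E.incomeLaw i (θ i))
        = E.interim i x (M.q i) * x - E.U M i x x := by
  have := hE.f_prob
  have := hE.isProbabilityMeasure_profileLaw
  set κ : ProbabilityTheory.Kernel (Fin N → ℝ) ℝ :=
    ⟨fun θ => E.incomeLaw i (E.clampType i (θ i)), hE.measurable_incomeLaw i⟩ with hκ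
  have hκm : ProbabilityTheory.IsMarkovKernel κ := ⟨fun θ => hE.g_prob i _ (hE.clampType_mem i _)⟩
  have hκ' : ∀ θ, κ θ = E.incomeLaw i (E.clampType i (θ i)) := fun _ => rfl
  have hκt : ∀ θ ∈ E.profiles, κ θ = E.incomeLaw i (θ i) := fun θ hθ => by
    rw [hκ', clampType_of_mem (hθ i)]
  -- Payments are measurable only as functions on the histories, so they are set to zero elsewhere.
  set k : (Fin N → ℝ) × ℝ → ℝ := (E.histories i).indicator fun h => pay M i h.1 h.2 with hk
  have hkm : Measurable k :=
    measurable_indicator_of_domRestrict (hE.measurableSet_histories i) (hM.measurable_pay i)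
  have hkeq : ∀ θ ∈ E.profiles, ∀ᵐ y ∂E.incomeLaw i (θ i), k (θ, y) = pay M i θ y := by
    intro θ hθ
    filter_upwards [ae_mem_incomes i (θ i)] with y hy
    exact indicator_of_mem (s := E.histories i) (show (θ, y) ∈ E.histories i from ⟨hθ, hy⟩) _
  have hint : ∀ θ ∈ E.profiles, ∫ y, k (θ, y) ∂κ θ = ∫ y, pay M i θ y ∂E.incomeLaw i (θ i) :=
    fun θ hθ => by rw [hκt θ hθ]; exact integral_congr_ae (hkeq θ hθ)
  set L : (Fin N → ℝ) → ENNReal := fun θ => ∫⁻ y, ‖k (θ, y)‖ₑ ∂κ θ with hL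
  have hLm : Measurable L := hkm.enorm.lintegral_kernel_prod_right'
  have hLfin : ∫⁻ θ, L θ ∂E.profileLaw < ⊤ := by
    refine lt_of_eq_of_lt (lintegral_congr_ae ?_) (hM.pay_integrable i)
    filter_upwards [hE.ae_mem_profiles] with θ hθ
    simp only [hL, hκt θ hθ]
    exact lintegral_congr_ae ((hkeq θ hθ).mono fun y hy => by simp only [hy, pay])
  have hInt : Integrable (fun θ => ∫ y, k (θ, y) ∂κ θ) E.profileLaw :=
    ⟨(StronglyMeasurable.integral_kernel_prod_right' (κ := κ)
      hkm.stronglyMeasurable).aestronglyMeasurable,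
      (lintegral_mono fun θ => enorm_integral_le_lintegral_enorm _).trans_lt hLfin⟩
  refine ⟨hInt.congr (hE.ae_mem_profiles.mono hint), ?_⟩
  -- Absolute integrability of payments is assumed only ex ante. It passes to almost every single
  -- type, and there the integrals over income and over the other types may be exchanged.
  have hLx : ∀ᵐ x ∂E.typeLaw i, ∫⁻ θ, L (Function.update θ i x) ∂E.profileLaw < ⊤ := by
    have mp := hE.measurePreserving_update_profileLaw i
    have hLu := hLm.comp (measurable_update_pair i)
    refine ae_lt_top (hLu.lintegral_prod_left') ?_
    have e1 := mp.lintegral_comp hLm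
    exact (((lintegral_prod_symm _ hLu.aemeasurable).symm.trans e1).trans_lt hLfin).ne
  filter_upwards [hLx, ae_mem_types i] with x hLx hx
  have := hE.g_prob i x hx
  have hkxm : Measurable fun z : (Fin N → ℝ) × ℝ => k (Function.update z.1 i x, z.2) :=
    hkm.comp (((measurable_update_const i x).comp measurable_fst).prodMk measurable_snd)
  have hκx : ∀ θ, κ (Function.update θ i x) = E.incomeLaw i x := fun θ => by
    rw [hκ', Function.update_self, clampType_of_mem hx]
  have hkxi : Integrable (Function.uncurry fun θ y => k (Function.update θ i x, y))
      (E.profileLaw.prod (E.incomeLaw i x)) := by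
    refine ⟨hkxm.aestronglyMeasurable, ?_⟩
    rw [hasFiniteIntegral_def]
    refine lt_of_eq_of_lt (lintegral_prod _ hkxm.enorm.aemeasurable) ?_
    simp only [hL, hκx] at hLx
    exact hLx
  have e1 : E.interim i x (fun θ => ∫ y, pay M i θ y ∂E.incomeLaw i (θ i))
      = ∫ θ, ∫ y, k (Function.update θ i x, y) ∂E.incomeLaw i x ∂E.profileLaw := by
    rw [← hE.interim_congr hx hint, interim]
    simp only [hκx]
  have e2 : ∀ᵐ y ∂E.incomeLaw i x, ∫ θ, k (Function.update θ i x, y) ∂E.profileLaw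
      = E.interim i x (M.q i) * y - E.u M i x (E.proj i x y) y := by
    filter_upwards [ae_mem_incomes i x] with y hy
    have hproj : E.proj i x y = y := by
      rw [proj, min_eq_left hy.2, EReal.toReal_coe, max_eq_right hy.1]
    rw [hproj, hM.u_eq hx hy (incomes_subset_allIncomes hx hy) hE, sub_sub_cancel]
    refine integral_congr_ae ?_
    filter_upwards [hE.ae_update_mem_profiles hx] with θ hθ
    exact indicator_of_mem (s := E.histories i) (show (Function.update θ i x, y) ∈ E.histories i
      from ⟨hθ, by simpa using hy⟩) _
  rw [e1, integral_integral_swap hkxi, integral_congr_ae e2,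
    integral_sub ((hE.income_integrable i x hx).const_mul _) (hM.u_integrable i x hx x hx),
    integral_const_mul, hE.income_mean i x hx]
  rfl

/-- The principal's revenue is the agents' expected income net of their rents. -/
theorem objective_eq (hc : ∀ i, E.c i = 0) :
    (∀ i, Integrable (fun x => E.interim i x (M.q i) * x - (E.U M i x x - E.T M i x))
      (E.typeLaw i)) ∧
    E.objective M
      = ∑ i, ∫ x, (E.interim i x (M.q i) * x - (E.U M i x x - E.T M i x)) ∂E.typeLaw i := by
  have key : ∀ i, Integrable (fun x => E.interim i x (M.q i) * x - (E.U M i x x - E.T M i x))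
      (E.typeLaw i) ∧ ∫ θ, (M.t i θ + M.q i θ *
        ∫ y, (M.r i θ y + M.a i θ y * (M.p i θ y y - E.c i)) ∂(E.incomeLaw i (θ i))) ∂E.profileLaw
      = ∫ x, (E.interim i x (M.q i) * x - (E.U M i x x - E.T M i x)) ∂E.typeLaw i := by
    intro i
    obtain ⟨h1, h2⟩ := hM.interim_expected_pay hE i
    have hT := hE.integrable_interim i (hM.t_integrable i)
    have hP := hE.integrable_interim i h1
    have hae : (fun x => E.T M i x + E.interim i x (fun θ => ∫ y, pay M i θ y ∂E.incomeLaw i (θ i)))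
        =ᵐ[E.typeLaw i] fun x => E.interim i x (M.q i) * x - (E.U M i x x - E.T M i x) := by
      filter_upwards [h2] with x hx
      rw [hx]
      ring
    refine ⟨(hT.add hP).congr hae, ?_⟩
    have e : ∀ θ, M.t i θ + M.q i θ *
        ∫ y, (M.r i θ y + M.a i θ y * (M.p i θ y y - E.c i)) ∂(E.incomeLaw i (θ i))
        = M.t i θ + ∫ y, pay M i θ y ∂E.incomeLaw i (θ i) := fun θ => by
      simp only [pay, integral_const_mul, hc i, sub_zero]
    simp only [e]
    rw [integral_add (hM.t_integrable i) h1, ← hE.integral_interim i (hM.t_integrable i),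
      ← hE.integral_interim i h1, ← integral_congr_ae hae]
    exact (integral_add hT hP).symm
  exact ⟨fun i => (key i).1, Finset.sum_congr rfl fun i _ => (key i).2⟩

end IsMechanism

theorem proj_of_mem {i : Fin N} {x y : ℝ} (hy : y ∈ E.incomes i x) : E.proj i x y = y := by
  rw [proj, min_eq_left hy.2, EReal.toReal_coe, max_eq_right hy.1]

/-! ### Rents -/

namespace Feasible

variable {M : Mechanism N} (hE : E.Standing) (hM : E.Feasible M)

include hE hM

/-- With both reports held fixed, extra income d raises the penalty by at most φ d, and an audit
probability of at most one can only shrink this nonnegative increase. -/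
theorem u_sub_ge {i : Fin N} {x y' y z : ℝ} (hx : x ∈ E.types i) (hy' : y' ∈ E.incomes i x)
    (hy : y ∈ E.allIncomes i) (hz : z ∈ E.allIncomes i) (hyz : y ≤ z) :
    (1 - E.φ i) * E.interim i x (M.q i) * (z - y) ≤ E.u M i x y' z - E.u M i x y' y := by
  rcases hyz.eq_or_lt with rfl | hlt
  · simp
  have hq := hE.integrable_update_of_mem_Icc (hM.isMechanism.q_meas i)
    (hM.isMechanism.q_mem_Icc i) hx
  rw [hM.isMechanism.u_eq hx hy' hy hE, hM.isMechanism.u_eq hx hy' hz hE]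
  have hpz := hM.isMechanism.pay_interim i x hx y' hy' z hz
  have hpy := hM.isMechanism.pay_interim i x hx y' hy' y hy
  have hle : E.interim i x (fun θ => M.q i θ * (M.r i θ y' + M.a i θ y' * M.p i θ y' z))
      ≤ E.interim i x (fun θ => M.q i θ * (M.r i θ y' + M.a i θ y' * M.p i θ y' y))
        + E.interim i x (M.q i) * (E.φ i * (z - y)) := by
    rw [interim, interim, interim, ← integral_mul_const,
      ← integral_add hpy (hq.mul_const _)]
    refine integral_mono_ae hpz (hpy.add (hq.mul_const _)) ?_
    filter_upwards [hE.ae_update_mem_profiles hx] with θ hθ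
    have hh : (Function.update θ i x, y') ∈ E.histories i := ⟨hθ, by simpa using hy'⟩
    have ha := hM.isMechanism.a_mem i _ hh
    have hd := hM.doubleMonotone i _ hh y hy z hz hlt
    have hq0 := hM.isMechanism.q_nonneg i _ hθ
    simp only at ha hd ⊢
    rw [← mul_add]
    refine mul_le_mul_of_nonneg_left ?_ hq0
    nlinarith [mul_le_mul_of_nonneg_right ha.2 hd.1]
  linarith

/-- The interval from y to z is cut at the end points of the income interval of x. Beyond them the
projected report is constant and `u_sub_ge` applies. Inside, income z does at least as well by
truth-telling as by reporting the lower income, which again fixes the report. -/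
theorem truthful_u_sub_ge {i : Fin N} {x y z : ℝ} (hx : x ∈ E.types i)
    (hy : y ∈ E.allIncomes i) (hz : z ∈ E.allIncomes i) (hyz : y ≤ z) :
    (1 - E.φ i) * E.interim i x (M.q i) * (z - y)
      ≤ E.u M i x (E.proj i x z) z - E.u M i x (E.proj i x y) y := by
  have hlohi := hE.incLo_lt_incHi i x hx
  have hlo : E.incLo i x ∈ E.incomes i x := ⟨le_rfl, hlohi.le⟩
  have hsub := incomes_subset_allIncomes hx
  have projlo : ∀ w : ℝ, w ≤ E.incLo i x → E.proj i x w = E.incLo i x := fun w hw => by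
    have : (w : EReal) ≤ E.incHi i x := (EReal.coe_le_coe_iff.2 hw).trans hlohi.le
    rw [proj, min_eq_left this, EReal.toReal_coe, max_eq_left hw]
  have above : ∀ w ∈ E.allIncomes i, ∀ v ∈ E.allIncomes i, w ≤ v → E.incHi i x ≤ (w : EReal) →
      (1 - E.φ i) * E.interim i x (M.q i) * (v - w)
        ≤ E.u M i x (E.proj i x v) v - E.u M i x (E.proj i x w) w := by
    intro w hw v hv hwv hhi
    have hbot : E.incHi i x ≠ ⊥ := ((EReal.bot_lt_coe _).trans hlohi).ne'
    have htop : E.incHi i x ≠ ⊤ := (hhi.trans_lt (EReal.coe_lt_top w)).ne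
    have projhi : ∀ w : ℝ, E.incHi i x ≤ (w : EReal) → E.proj i x w = (E.incHi i x).toReal :=
      fun w hw => by
        rw [proj, min_eq_right hw, max_eq_right]
        rw [← EReal.coe_le_coe_iff, EReal.coe_toReal htop hbot]
        exact hlohi.le
    rw [projhi w hhi, projhi v (hhi.trans (EReal.coe_le_coe_iff.2 hwv))]
    refine hM.u_sub_ge hE hx ⟨?_, ?_⟩ hw hv hwv
    · rw [← EReal.coe_le_coe_iff, EReal.coe_toReal htop hbot]
      exact hlohi.le
    · rw [EReal.coe_toReal htop hbot]
  have inside : ∀ w ∈ E.incomes i x, ∀ v ∈ E.incomes i x, w ≤ v →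
      (1 - E.φ i) * E.interim i x (M.q i) * (v - w)
        ≤ E.u M i x (E.proj i x v) v - E.u M i x (E.proj i x w) w := by
    intro w hw v hv hwv
    rw [proj_of_mem hw, proj_of_mem hv]
    have h1 := hM.icIncome i x hx v hv w hw
    have h2 := hM.u_sub_ge hE hx hw (hsub hw) (hsub hv) hwv
    linarith
  have fromInside : ∀ w ∈ E.incomes i x, ∀ v ∈ E.allIncomes i, w ≤ v →
      (1 - E.φ i) * E.interim i x (M.q i) * (v - w)
        ≤ E.u M i x (E.proj i x v) v - E.u M i x (E.proj i x w) w := by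
    intro w hw v hv hwv
    rcases le_or_gt (v : EReal) (E.incHi i x) with h | h
    · exact inside w hw v ⟨hw.1.trans hwv, h⟩ hwv
    · have hbot : E.incHi i x ≠ ⊥ := ((EReal.bot_lt_coe _).trans hlohi).ne'
      have htop : E.incHi i x ≠ ⊤ := (h.trans (EReal.coe_lt_top v)).ne
      have hcoe := EReal.coe_toReal htop hbot
      set m := (E.incHi i x).toReal
      have hm : m ∈ E.incomes i x :=
        ⟨by rw [← EReal.coe_le_coe_iff, hcoe]; exact hlohi.le, hcoe.le⟩
      have hwm : w ≤ m := by rw [← EReal.coe_le_coe_iff, hcoe]; exact hw.2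
      have hmv : m ≤ v := by rw [← EReal.coe_le_coe_iff, hcoe]; exact h.le
      have h1 := inside w hw m hm hwm
      have h2 := above m (hsub hm) v hv hmv hcoe.ge
      linarith
  rcases le_or_gt y (E.incLo i x) with h | h
  · have below : ∀ v ∈ E.allIncomes i, y ≤ v → v ≤ E.incLo i x →
        (1 - E.φ i) * E.interim i x (M.q i) * (v - y)
          ≤ E.u M i x (E.proj i x v) v - E.u M i x (E.proj i x y) y := by
      intro v hv hyv hvlo
      rw [projlo y h, projlo v hvlo]
      exact hM.u_sub_ge hE hx hlo hy hv hyv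
    rcases le_or_gt z (E.incLo i x) with h' | h'
    · exact below z hz hyz h'
    · have h1 := below _ (hsub hlo) h le_rfl
      have h2 := fromInside _ hlo z hz h'.le
      linarith
  · rcases le_or_gt (y : EReal) (E.incHi i x) with h' | h'
    · exact fromInside y ⟨h.le, h'⟩ z hz hyz
    · exact above y hy z hz hyz h'.le

/-- A higher type can imitate a lower one and keep the unroyaltied part of the income gain. -/
theorem rent_sub_ge {i : Fin N} {x' x : ℝ} (hx' : x' ∈ E.types i) (hx : x ∈ E.types i)
    (hle : x' ≤ x) :
    (1 - E.φ i) * E.interim i x' (M.q i) * (x - x')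
      ≤ (E.U M i x x - E.T M i x) - (E.U M i x' x' - E.T M i x') := by
  have := hE.g_prob i x hx
  have := hE.g_prob i x' hx'
  set k := (1 - E.φ i) * E.interim i x' (M.q i)
  have hu := hM.isMechanism.u_integrable i x' hx'
  have hy : ∀ z ∈ E.types i, Integrable (fun y => k * y) (E.incomeLaw i z) := fun z hz =>
    (hE.income_integrable i z hz).const_mul k
  -- Dominance is applied to utility minus its guaranteed linear part; the linear part has
  -- expectation k times the type.
  have hmono : MonotoneOn (fun y => E.u M i x' (E.proj i x' y) y - k * y) (E.allIncomes i) := by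
    intro y hy z hz hyz
    have := hM.truthful_u_sub_ge hE hx' hy hz hyz
    simp only
    linarith
  have hdom := integral_le_of_stochasticDominance (ae_mem_allIncomes hx) (ae_mem_allIncomes hx')
    (fun y => by
      have := hE.antitoneOn_G i y hx' hx hle
      exact (ENNReal.toReal_le_toReal (measure_ne_top _ _) (measure_ne_top _ _)).1 this)
    hmono ((hu x hx).sub (hy x hx)) ((hu x' hx').sub (hy x' hx'))
  rw [integral_sub (hu x hx) (hy x hx), integral_sub (hu x' hx') (hy x' hx'), integral_const_mul,
    integral_const_mul, hE.income_mean i x hx, hE.income_mean i x' hx'] at hdom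
  have hic := hM.icType i x hx x' hx'
  simp only [U] at hic ⊢
  linarith

/-- The increments of `rent_sub_ge` are summed by `intervalIntegral_le_sub_of_mul_le`, starting from
individual rationality at the lowest type. -/
theorem rent_ge {i : Fin N} {x : ℝ} (hx : x ∈ E.types i) :
    (1 - E.φ i) * ∫ z in (E.tlo i)..x, E.interim i z (M.q i) ≤ E.U M i x x - E.T M i x := by
  obtain ⟨k, hkm, hk01, hk⟩ := hE.exists_measurable_interim (hM.isMechanism.q_meas i)
    (hM.isMechanism.q_mem_Icc i) i
  have hφ := hE.φ_mem i
  have hlo : E.tlo i ∈ E.types i := ⟨le_rfl, hE.lo_le_hi i⟩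
  have hsub : Icc (E.tlo i) x ⊆ E.types i := Icc_subset_Icc le_rfl hx.2
  have hki : IntervalIntegrable (fun z => (1 - E.φ i) * k z) volume (E.tlo i) x :=
    IntervalIntegrable.const_mul ((intervalIntegrable_iff_integrableOn_Ioc_of_le hx.1).2 (Integrable.of_bound (C := 1)
      hkm.aestronglyMeasurable (ae_of_all _ fun z => by
        rw [Real.norm_eq_abs, abs_of_nonneg (hk01 z).1]
        exact (hk01 z).2))) _
  have key := intervalIntegral_le_sub_of_mul_le hx.1 (V := fun x => E.U M i x x - E.T M i x) hki
    (fun z _ => mul_nonneg (sub_nonneg.2 hφ.2) (hk01 z).1)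
    (fun z hz w hw hzw => by
      have := hM.rent_sub_ge hE (hsub hz) (hsub hw) hzw
      rwa [hk z (hsub hz)] at this)
  have hir := hM.ir i _ hlo
  rw [intervalIntegral.integral_const_mul] at key
  have e : ∫ z in (E.tlo i)..x, E.interim i z (M.q i) = ∫ z in (E.tlo i)..x, k z := by
    refine intervalIntegral.integral_congr fun z hz => ?_
    rw [uIcc_of_le hx.1] at hz
    exact hk z (hsub hz)
  rw [e]
  linarith

end Feasible

/-! ### Virtual surplus -/

namespace Standing

variable (hE : E.Standing)

include hE

theorem monotone_F (i : Fin N) : Monotone (E.F i) :=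
  have := hE.f_prob i
  fun _ _ h => measureReal_mono (Iic_subset_Iic.2 h)

/-- The inverse hazard rate may blow up where f vanishes, but its product with f is `1 - F`, which
is bounded. -/
theorem integrable_hazard (i : Fin N) : Integrable (E.hazard i) (E.typeLaw i) := by
  rw [hE.integrable_typeLaw_iff, IntegrableOn, types,
    Measure.restrict_congr_set (Ioo_ae_eq_Icc (a := E.tlo i) (b := E.thi i)).symm]
  have h1 : Integrable (fun x => 1 - E.F i x) (volume.restrict (Ioo (E.tlo i) (E.thi i))) :=
    Integrable.of_bound (C := 1)
      (measurable_const.sub (hE.monotone_F i).measurable).aestronglyMeasurable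
      (ae_of_all _ fun x => by
        have h0 : 0 ≤ E.F i x := measureReal_nonneg
        rw [Real.norm_eq_abs, abs_of_nonneg (sub_nonneg.2 (hE.F_le_one i x))]
        linarith)
  refine h1.congr ?_
  filter_upwards [ae_restrict_mem measurableSet_Ioo] with x hx
  rw [hE.f_mul_hazard hx]

theorem integrable_id_typeLaw (i : Fin N) : Integrable (fun x => x) (E.typeLaw i) := by
  have := hE.f_prob i
  refine Integrable.of_bound (C := max |E.tlo i| |E.thi i|) measurable_id.aestronglyMeasurable ?_
  filter_upwards [ae_mem_types i] with x hx
  exact abs_le_max_abs_abs hx.1 hx.2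

theorem integrable_psi0Formula (i : Fin N) : Integrable (E.psi0Formula i) (E.typeLaw i) :=
  (hE.integrable_id_typeLaw i).sub ((hE.integrable_hazard i).const_mul _)

/-- Integration of a primitive against the type distribution. -/
theorem integral_primitive {i : Fin N} {k : ℝ → ℝ} (hk : Measurable k)
    (hk01 : ∀ x, k x ∈ Icc (0 : ℝ) 1) :
    Integrable (fun x => ∫ z in (E.tlo i)..x, k z) (E.typeLaw i) ∧
    ∫ x, (∫ z in (E.tlo i)..x, k z) ∂E.typeLaw i = ∫ x, k x * E.hazard i x ∂E.typeLaw i := by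
  have := hE.f_prob i
  set ρ := volume.restrict (Ioc (E.tlo i) (E.thi i))
  -- Fubini on the triangle `z ≤ x`: integrating out x leaves `k z * (1 - F z)`, and `1 - F` is the
  -- density times the inverse hazard rate.
  set Φ : ℝ × ℝ → ℝ := {p : ℝ × ℝ | p.2 ≤ p.1}.indicator fun p => k p.2 with hΦ
  have hΦm : Measurable Φ :=
    (hk.comp measurable_snd).indicator (measurableSet_le measurable_snd measurable_fst)
  have hΦi : Integrable (Function.uncurry fun x z => Φ (x, z)) ((E.typeLaw i).prod ρ) := by
    refine Integrable.of_bound (C := 1) hΦm.aestronglyMeasurable (ae_of_all _ fun p => ?_)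
    simp only [Function.uncurry, hΦ, indicator_apply]
    split_ifs
    · rw [Real.norm_eq_abs, abs_of_nonneg (hk01 _).1]
      exact (hk01 _).2
    · simp
  have e1 : ∀ᵐ x ∂E.typeLaw i, ∫ z, Φ (x, z) ∂ρ = ∫ z in (E.tlo i)..x, k z := by
    filter_upwards [ae_mem_types i] with x hx
    have : (fun z => Φ (x, z)) = (Iic x).indicator k := by
      ext z
      simp [hΦ, indicator_apply]
    rw [this, integral_indicator measurableSet_Iic, Measure.restrict_restrict measurableSet_Iic,
      intervalIntegral.integral_of_le hx.1]
    congr 2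
    ext z
    simp only [mem_inter_iff, mem_Iic, mem_Ioc]
    exact ⟨fun h => ⟨h.2.1, h.1⟩, fun h => ⟨h.2, h.1, h.2.trans hx.2⟩⟩
  have e2 : ∀ z, ∫ x, Φ (x, z) ∂E.typeLaw i = k z * (1 - E.F i z) := by
    intro z
    have : (fun x => Φ (x, z)) = (Ici z).indicator fun _ => k z := by
      ext x
      simp [hΦ, indicator_apply]
    rw [this, integral_indicator_const _ measurableSet_Ici, smul_eq_mul, mul_comm, F,
      ← probReal_compl_eq_one_sub measurableSet_Iic, compl_Iic, measureReal_def, measureReal_def,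
      measure_congr Ioi_ae_eq_Ici]
  refine ⟨hΦi.integral_prod_left.congr e1, ?_⟩
  rw [← integral_congr_ae e1, integral_integral_swap hΦi, hE.integral_typeLaw,
    intervalIntegral.integral_of_le (hE.lo_le_hi i), integral_Ioc_eq_integral_Ioo,
    integral_Ioc_eq_integral_Ioo]
  refine setIntegral_congr_fun measurableSet_Ioo fun x hx => ?_
  simp only [e2, ← hE.f_mul_hazard hx]
  ring

/-- The revenue from an agent whose rent is the smallest possible one is the virtual surplus. -/
theorem integral_virtualSurplus {i : Fin N} {q : (Fin N → ℝ) → ℝ}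
    (hm : Measurable (E.profiles.domRestrict q)) (h01 : ∀ θ ∈ E.profiles, q θ ∈ Icc (0 : ℝ) 1) :
    Integrable (fun θ => q θ * E.psi0Formula i (θ i)) E.profileLaw ∧
    Integrable (fun x => E.interim i x q * x
      - (1 - E.φ i) * ∫ z in (E.tlo i)..x, E.interim i z q) (E.typeLaw i) ∧
    ∫ x, (E.interim i x q * x - (1 - E.φ i) * ∫ z in (E.tlo i)..x, E.interim i z q) ∂E.typeLaw i
      = ∫ θ, q θ * E.psi0Formula i (θ i) ∂E.profileLaw := by
  have := hE.f_prob
  obtain ⟨k, hkm, hk01, hk⟩ := hE.exists_measurable_interim hm h01 i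
  have hkb : ∀ x, ‖k x‖ ≤ 1 := fun x => by
    rw [Real.norm_eq_abs, abs_of_nonneg (hk01 x).1]
    exact (hk01 x).2
  have hint : Integrable (fun θ => q θ * E.psi0Formula i (θ i)) E.profileLaw := by
    have mp : MeasurePreserving (Function.eval i) E.profileLaw (E.typeLaw i) :=
      measurePreserving_eval E.typeLaw i
    have hv := (mp.integrable_comp (hE.integrable_psi0Formula i).aestronglyMeasurable).2
      (hE.integrable_psi0Formula i)
    refine Integrable.bdd_mul (c := 1) hv (hE.integrable_of_mem_Icc hm h01).aestronglyMeasurable ?_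
    filter_upwards [hE.ae_mem_profiles] with θ hθ
    rw [Real.norm_eq_abs, abs_of_nonneg (h01 θ hθ).1]
    exact (h01 θ hθ).2
  obtain ⟨hp1, hp2⟩ := hE.integral_primitive (i := i) hkm hk01
  have hkx : Integrable (fun x => k x * x) (E.typeLaw i) :=
    (hE.integrable_id_typeLaw i).bdd_mul (c := 1) hkm.aestronglyMeasurable (ae_of_all _ hkb)
  have hkh : Integrable (fun x => k x * E.hazard i x) (E.typeLaw i) :=
    (hE.integrable_hazard i).bdd_mul (c := 1) hkm.aestronglyMeasurable (ae_of_all _ hkb)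
  have e1 : (fun x => k x * x - (1 - E.φ i) * ∫ z in (E.tlo i)..x, k z) =ᵐ[E.typeLaw i]
      fun x => E.interim i x q * x - (1 - E.φ i) * ∫ z in (E.tlo i)..x, E.interim i z q := by
    filter_upwards [ae_mem_types i] with x hx
    have : ∫ z in (E.tlo i)..x, E.interim i z q = ∫ z in (E.tlo i)..x, k z := by
      refine intervalIntegral.integral_congr fun z hz => ?_
      rw [uIcc_of_le hx.1] at hz
      exact hk z ⟨hz.1, hz.2.trans hx.2⟩
    rw [this, hk x hx]
  have e2 : (fun x => E.interim i x fun θ => q θ * E.psi0Formula i (θ i)) =ᵐ[E.typeLaw i]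
      fun x => k x * x - (1 - E.φ i) * (k x * E.hazard i x) := by
    filter_upwards [ae_mem_types i] with x hx
    simp only [interim, Function.update_self]
    rw [integral_mul_const, ← interim, hk x hx, psi0Formula, ← hazard]
    ring
  refine ⟨hint, (hkx.sub (hp1.const_mul _)).congr e1, ?_⟩
  rw [← integral_congr_ae e1, integral_sub hkx (hp1.const_mul _), integral_const_mul, hp2,
    ← hE.integral_interim i hint, integral_congr_ae e2, integral_sub hkx (hkh.const_mul _),
    integral_const_mul]

end Standing

theorem Feasible.objective_le {M : Mechanism N} (hM : E.Feasible M) (hE : E.Standing)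
    (hc : ∀ i, E.c i = 0) :
    E.objective M ≤ ∑ i, ∫ θ, M.q i θ * E.psi0Formula i (θ i) ∂E.profileLaw := by
  obtain ⟨h1, h2⟩ := hM.isMechanism.objective_eq hE hc
  rw [h2]
  refine Finset.sum_le_sum fun i _ => ?_
  obtain ⟨-, hv1, hv2⟩ := hE.integral_virtualSurplus (i := i) (hM.isMechanism.q_meas i)
    (hM.isMechanism.q_mem_Icc i)
  rw [← hv2]
  refine integral_mono_ae (h1 i) hv1 ?_
  filter_upwards [ae_mem_types i] with x hx
  have := hM.rent_ge hE hx
  linarith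

/-! ### The free-auditing mechanism -/

section FreeMechanism

variable (hE : E.Standing)
  (hψ : ∀ i, StrictMonoOn (E.psi0Formula i) (Ioo (E.tlo i) (E.thi i)))

/-- The interim allocation of the free-auditing mechanism. -/
noncomputable def freeInterim (E : Primitives N) (i : Fin N) (x : ℝ) : ℝ :=
  E.interim i x (allocate E.psi0 i)

/-- Royalty `y' φ` and penalty `(y - y') φ` add up to `y φ`, so the income report drops out: income
incentive constraints hold with equality. -/
theorem freeMechanism_u_eq (i : Fin N) (x y' y : ℝ) :
    E.u E.freeMechanism i x y' y = E.freeInterim i x * (1 - E.φ i) * y := by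
  rw [u, freeInterim, interim, interim, mul_assoc, ← integral_mul_const]
  congr 1
  ext θ
  simp only [freeMechanism]
  ring

theorem freeInterim_nonneg (i : Fin N) (x : ℝ) : 0 ≤ E.freeInterim i x :=
  integral_nonneg fun _ => (allocate_mem _ i _).1

include hE

theorem freeMechanism_U_eq {i : Fin N} {x : ℝ} (hx : x ∈ E.types i) (x' : ℝ) :
    E.U E.freeMechanism i x' x = E.freeInterim i x' * (1 - E.φ i) * x := by
  simp only [U, freeMechanism_u_eq]
  rw [integral_const_mul, hE.income_mean i x hx]

include hψ

theorem measurable_allocate_psi0 (i : Fin N) : Measurable (allocate E.psi0 i) :=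
  measurable_allocate (fun j => measurable_psi0 (hψ j) hE) i

theorem integrable_allocate_update (i : Fin N) (x : ℝ) :
    Integrable (fun θ => allocate E.psi0 i (Function.update θ i x)) E.profileLaw := by
  have := hE.isProbabilityMeasure_profileLaw
  refine Integrable.of_bound (C := 1) ((measurable_allocate_psi0 hE hψ i).comp
    (measurable_update_const i x)).aestronglyMeasurable (ae_of_all _ fun θ => ?_)
  have h := allocate_mem E.psi0 i (Function.update θ i x)
  rw [Real.norm_eq_abs, abs_of_nonneg h.1]
  exact h.2

theorem monotoneOn_freeInterim (i : Fin N) : MonotoneOn (E.freeInterim i) (E.types i) :=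
  fun _ hx _ hx' h => integral_mono (integrable_allocate_update hE hψ i _)
    (integrable_allocate_update hE hψ i _) fun θ =>
      monotoneOn_allocate_update (strictMonoOn_psi0 (hψ i)).monotoneOn θ hx hx' h

theorem freeMechanism_T_eq {i : Fin N} {x : ℝ} (hx : x ∈ E.types i) :
    E.T E.freeMechanism i x
      = (1 - E.φ i) * (E.freeInterim i x * x - ∫ z in (E.tlo i)..x, E.freeInterim i z) := by
  have := hE.isProbabilityMeasure_profileLaw
  have hΦ : Integrable (Function.uncurry fun (θ : Fin N → ℝ) z =>
      allocate E.psi0 i (Function.update θ i z))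
      (E.profileLaw.prod (volume.restrict (Ioc (E.tlo i) x))) := by
    refine Integrable.of_bound (C := 1) ((measurable_allocate_psi0 hE hψ i).comp
      (measurable_update_pair i)).aestronglyMeasurable (ae_of_all _ fun p => ?_)
    have h := allocate_mem E.psi0 i (Function.update p.1 i p.2)
    rw [Real.norm_eq_abs, Function.uncurry, abs_of_nonneg h.1]
    exact h.2
  simp only [T, interim, freeMechanism, Function.update_self, Function.update_idem,
    intervalIntegral.integral_of_le hx.1]
  have hΦl : Integrable (fun θ : Fin N → ℝ =>
      ∫ z in Ioc (E.tlo i) x, allocate E.psi0 i (Function.update θ i z)) E.profileLaw :=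
    hΦ.integral_prod_left
  rw [integral_const_mul, integral_sub ((integrable_allocate_update hE hψ i x).mul_const x) hΦl,
    integral_mul_const, integral_integral_swap hΦ]
  rfl

/-- This is exactly the lower bound of `Feasible.rent_ge`, so no feasible mechanism with the same
allocation leaves smaller rents. -/
theorem freeMechanism_rent_eq {i : Fin N} {x : ℝ} (hx : x ∈ E.types i) :
    E.U E.freeMechanism i x x - E.T E.freeMechanism i x
      = (1 - E.φ i) * ∫ z in (E.tlo i)..x, E.freeInterim i z := by
  rw [freeMechanism_U_eq hE hx, freeMechanism_T_eq hE hψ hx]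
  ring

/-- On type profiles the transfers are given by a bounded measurable function. -/
theorem exists_freeMechanism_t (i : Fin N) :
    ∃ t : (Fin N → ℝ) → ℝ, Measurable t ∧ (∃ C, ∀ θ, ‖t θ‖ ≤ C) ∧
      ∀ θ ∈ E.profiles, E.freeMechanism.t i θ = t θ := by
  set ρ := volume.restrict (Ioc (E.tlo i) (E.thi i))
  -- The upper limit `θ i` of the integral is moved into an indicator, so that measurability of
  -- parametric integrals over a fixed domain applies.
  set Φ : (Fin N → ℝ) × ℝ → ℝ := {p | p.2 ≤ p.1 i}.indicator fun p =>
    allocate E.psi0 i (Function.update p.1 i p.2) with hΦ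
  have hΦm : Measurable Φ :=
    ((measurable_allocate_psi0 hE hψ i).comp (measurable_update_pair i)).indicator
      (measurableSet_le measurable_snd ((measurable_pi_apply i).comp measurable_fst))
  have hΦ1 : ∀ p, ‖Φ p‖ ≤ 1 := fun p => by
    have h := allocate_mem E.psi0 i (Function.update p.1 i p.2)
    simp only [hΦ, indicator_apply]
    split_ifs
    · rw [Real.norm_eq_abs, abs_of_nonneg h.1]
      exact h.2
    · simp
  have hIm : Measurable fun θ => ∫ z, Φ (θ, z) ∂ρ :=
    (StronglyMeasurable.integral_prod_right' hΦm.stronglyMeasurable).measurable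
  refine ⟨fun θ => (1 - E.φ i) * (allocate E.psi0 i θ * E.clampType i (θ i) - ∫ z, Φ (θ, z) ∂ρ),
    measurable_const.mul (((measurable_allocate_psi0 hE hψ i).mul
      ((measurable_clampType i).comp (measurable_pi_apply i))).sub hIm),
    ⟨‖1 - E.φ i‖ * (1 * max |E.tlo i| |E.thi i| + 1 * ρ.real univ), fun θ => ?_⟩,
    fun θ hθ => ?_⟩
  · rw [norm_mul]
    refine mul_le_mul_of_nonneg_left ((norm_sub_le _ _).trans (add_le_add ?_ ?_)) (norm_nonneg _)
    · rw [norm_mul]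
      have h := allocate_mem E.psi0 i θ
      have hc := hE.clampType_mem i (θ i)
      refine mul_le_mul ?_ (abs_le_max_abs_abs hc.1 hc.2) (norm_nonneg _) zero_le_one
      rw [Real.norm_eq_abs, abs_of_nonneg h.1]
      exact h.2
    · exact norm_integral_le_of_norm_le_const (ae_of_all _ fun z => hΦ1 _)
  · have : (fun z => Φ (θ, z))
        = (Iic (θ i)).indicator fun z => allocate E.psi0 i (Function.update θ i z) := by
      ext z
      simp [hΦ, indicator_apply]
    have hset : Iic (θ i) ∩ Ioc (E.tlo i) (E.thi i) = Ioc (E.tlo i) (θ i) := by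
      ext z
      simp only [mem_inter_iff, mem_Iic, mem_Ioc]
      exact ⟨fun h => ⟨h.2.1, h.1⟩, fun h => ⟨h.2, h.1, h.2.trans (hθ i).2⟩⟩
    simp only [freeMechanism, clampType_of_mem (hθ i)]
    rw [this, integral_indicator measurableSet_Iic, Measure.restrict_restrict measurableSet_Iic,
      hset, intervalIntegral.integral_of_le (hθ i).1]

theorem isMechanism_freeMechanism : E.IsMechanism E.freeMechanism := by
  have := hE.isProbabilityMeasure_profileLaw
  refine
    { q_nonneg := fun i θ _ => (allocate_mem _ i θ).1
      q_sum := fun θ _ => sum_allocate_le_one _ θ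
      a_mem := fun i h _ => ⟨zero_le_one, le_rfl⟩
      q_meas := fun i => (measurable_allocate_psi0 hE hψ i).comp measurable_subtype_coe
      t_meas := fun i => ?_
      r_meas := fun i => (measurable_snd.comp measurable_subtype_coe).mul_const _
      a_meas := fun i => measurable_const
      p_meas := fun i => ((measurable_snd.comp measurable_subtype_coe).sub
        (measurable_snd.comp (measurable_fst.comp measurable_subtype_coe))).mul_const _
      t_integrable := fun i => ?_
      t_interim := fun i x hx => ?_
      pay_integrable := fun i => ?_
      pay_interim := fun i x _ y' _ y _ => (integrable_allocate_update hE hψ i x).mul_const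
        (y' * E.φ i + 1 * ((y - y') * E.φ i))
      u_integrable := fun i x' _ x hx => ?_ }
  · obtain ⟨t, ht, -, he⟩ := exists_freeMechanism_t hE hψ i
    have : E.profiles.domRestrict (E.freeMechanism.t i) = t ∘ Subtype.val := by
      ext θ
      exact he θ θ.2
    rw [this]
    exact ht.comp measurable_subtype_coe
  · obtain ⟨t, ht, ⟨C, hC⟩, he⟩ := exists_freeMechanism_t hE hψ i
    refine (Integrable.of_bound ht.aestronglyMeasurable C (ae_of_all _ hC)).congr ?_
    exact hE.ae_mem_profiles.mono fun θ hθ => (he θ hθ).symm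
  · obtain ⟨t, ht, ⟨C, hC⟩, he⟩ := exists_freeMechanism_t hE hψ i
    refine (Integrable.of_bound (ht.comp (measurable_update_const i x)).aestronglyMeasurable C
      (ae_of_all _ fun θ => hC _)).congr ?_
    exact (hE.ae_update_mem_profiles hx).mono fun θ hθ => (he _ hθ).symm
  -- The payment is `q φ y ≤ y`, and mean income is `θ i`, at most `thi`.
  · have hbound : ∀ᵐ θ ∂E.profileLaw, ∫⁻ y, ‖E.freeMechanism.q i θ * (E.freeMechanism.r i θ y
        + E.freeMechanism.a i θ y * E.freeMechanism.p i θ y y)‖ₑ ∂E.incomeLaw i (θ i)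
        ≤ ENNReal.ofReal (E.thi i) := by
      filter_upwards [hE.ae_mem_profiles] with θ hθ
      have hφ := hE.φ_mem i
      have hq := allocate_mem E.psi0 i θ
      have hnn := hE.ae_income_nonneg (hθ i)
      calc _ ≤ ∫⁻ y, ENNReal.ofReal y ∂E.incomeLaw i (θ i) := by
            refine lintegral_mono_ae (hnn.mono fun y hy => ?_)
            have e : E.freeMechanism.q i θ * (E.freeMechanism.r i θ y
                + E.freeMechanism.a i θ y * E.freeMechanism.p i θ y y)
                = allocate E.psi0 i θ * E.φ i * y := by
              simp only [freeMechanism]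
              ring
            rw [e, Real.enorm_of_nonneg (mul_nonneg (mul_nonneg hq.1 hφ.1) hy)]
            exact ENNReal.ofReal_le_ofReal
              (mul_le_of_le_one_left hy (mul_le_one₀ hq.2 hφ.1 hφ.2))
        _ = ENNReal.ofReal (θ i) := by
            rw [← ofReal_integral_eq_lintegral_ofReal (hE.income_integrable i _ (hθ i)) hnn,
              hE.income_mean i _ (hθ i)]
        _ ≤ ENNReal.ofReal (E.thi i) := ENNReal.ofReal_le_ofReal (hθ i).2
    refine (lintegral_mono_ae hbound).trans_lt ?_
    simp
  · simp only [freeMechanism_u_eq]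
    exact (hE.income_integrable i x hx).const_mul _

theorem feasible_freeMechanism : E.Feasible E.freeMechanism := by
  have hmono := fun i => monotoneOn_freeInterim hE hψ i
  have hint : ∀ i, ∀ a ∈ E.types i, ∀ b ∈ E.types i,
      IntervalIntegrable (E.freeInterim i) volume a b := fun i a ha b hb =>
    ((hmono i).mono (ordConnected_Icc.uIcc_subset ha hb)).intervalIntegrable
  have hlo : ∀ i, E.tlo i ∈ E.types i := fun i => ⟨le_rfl, hE.lo_le_hi i⟩
  refine ⟨isMechanism_freeMechanism hE hψ, ?_, ?_, ?_, ?_⟩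
  · intro i h _ y _ z _ hyz
    have hφ := hE.φ_mem i
    have e : E.freeMechanism.p i h.1 h.2 z - E.freeMechanism.p i h.1 h.2 y = (z - y) * E.φ i := by
      simp only [freeMechanism]
      ring
    rw [e]
    exact ⟨mul_nonneg (sub_nonneg.2 hyz.le) hφ.1, le_rfl⟩
  · intro i x _ y _ y' _
    simp only [freeMechanism_u_eq, le_refl]
  · intro i x hx x' hx'
    rw [freeMechanism_rent_eq hE hψ hx, freeMechanism_U_eq hE hx, freeMechanism_T_eq hE hψ hx']
    have hadd := intervalIntegral.integral_add_adjacent_intervals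
      (hint i _ (hlo i) x' hx') (hint i x' hx' x hx)
    -- Given the rent formula, incentive compatibility in types reduces to this inequality, up to
    -- the factor `1 - φ`. It holds for either order of x and x' because the interim allocation is
    -- monotone.
    have key : E.freeInterim i x' * (x - x') ≤ ∫ z in x'..x, E.freeInterim i z := by
      rcases le_total x' x with h | h
      · have := intervalIntegral.integral_mono_on h (by simp) (hint i x' hx' x hx)
          (f := fun _ => E.freeInterim i x')
          fun z hz => hmono i hx' ⟨hx'.1.trans hz.1, hz.2.trans hx.2⟩ hz.1
        simp only [intervalIntegral.integral_const, smul_eq_mul] at this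
        linarith
      · have := intervalIntegral.integral_mono_on h (hint i x hx x' hx') (by simp)
          (g := fun _ => E.freeInterim i x')
          fun z hz => hmono i ⟨hx.1.trans hz.1, hz.2.trans hx'.2⟩ hx' hz.2
        simp only [intervalIntegral.integral_const, smul_eq_mul] at this
        rw [intervalIntegral.integral_symm]
        linarith
    have := mul_le_mul_of_nonneg_left key (sub_nonneg.2 (hE.φ_mem i).2)
    rw [← hadd]
    linarith
  · intro i x hx
    rw [freeMechanism_rent_eq hE hψ hx]
    exact mul_nonneg (sub_nonneg.2 (hE.φ_mem i).2) (intervalIntegral.integral_nonneg hx.1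
      fun z _ => freeInterim_nonneg i z)

/-! ### Revenue of the free-auditing mechanism and its optimality. -/

theorem freeMechanism_objective_eq (hc : ∀ i, E.c i = 0) :
    E.objective E.freeMechanism
      = ∑ i, ∫ θ, allocate E.psi0 i θ * E.psi0Formula i (θ i) ∂E.profileLaw := by
  have hM := isMechanism_freeMechanism hE hψ
  rw [(hM.objective_eq hE hc).2]
  refine Finset.sum_congr rfl fun i _ => ?_
  obtain ⟨-, -, hv⟩ := hE.integral_virtualSurplus (i := i) (hM.q_meas i) (hM.q_mem_Icc i)
  refine Eq.trans (integral_congr_ae ?_) hv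
  filter_upwards [ae_mem_types i] with x hx
  rw [freeMechanism_rent_eq hE hψ hx]
  rfl

/-- Ties between virtual values have probability zero. -/
theorem ae_psi0Formula_ne :
    ∀ᵐ θ ∂E.profileLaw, ∀ i j, i ≠ j → E.psi0Formula i (θ i) ≠ E.psi0Formula j (θ j) := by
  have := hE.f_prob
  have := hE.isProbabilityMeasure_profileLaw
  have hm : ∀ j, Measurable fun θ : Fin N → ℝ => E.psi0 j (θ j) := fun j =>
    (measurable_psi0 (hψ j) hE).comp (measurable_pi_apply j)
  have hne : ∀ i j, i ≠ j → ∀ᵐ θ ∂E.profileLaw, E.psi0 i (θ i) ≠ E.psi0 j (θ j) := by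
    intro i j hij
    have hA : MeasurableSet {θ : Fin N → ℝ | E.psi0 i (θ i) = E.psi0 j (θ j)} :=
      measurableSet_eq_fun (hm i) (hm j)
    have mp := hE.measurePreserving_update_profileLaw i
    suffices h : E.profileLaw {θ | E.psi0 i (θ i) = E.psi0 j (θ j)} = 0 from
      measure_eq_zero_iff_ae_notMem.1 h
    rw [← mp.measure_preimage hA.nullMeasurableSet, Measure.measure_prod_null (mp.measurable hA)]
    refine ae_of_all _ fun θ => ?_
    -- Once the type of j is fixed, strict monotonicity leaves at most one tying type of i, and type
    -- laws have no atoms.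
    have hsub : ({x | E.psi0 i x = E.psi0 j (θ j)} ∩ E.types i).Subsingleton :=
      fun x hx y hy => (strictMonoOn_psi0 (hψ i)).injOn hx.2 hy.2 (hx.1.trans hy.1.symm)
    have h0 := hsub.measure_zero (E.typeLaw i)
    refine measure_eq_zero_iff_ae_notMem.2 ?_
    filter_upwards [measure_eq_zero_iff_ae_notMem.1 h0, ae_mem_types i] with x hx hxt hmem
    refine hx ⟨?_, hxt⟩
    simpa [Function.update_of_ne hij.symm] using hmem
  have hall : ∀ᵐ θ ∂E.profileLaw, ∀ i j, i ≠ j → E.psi0 i (θ i) ≠ E.psi0 j (θ j) :=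
    eventually_all.2 fun i => eventually_all.2 fun j => by
      by_cases hij : i = j
      · exact Eventually.of_forall fun _ h => absurd hij h
      · exact (hne i j hij).mono fun _ h _ => h
  filter_upwards [hall, hE.ae_profile_Ioo] with θ h hθ i j hij heq
  refine h i j hij ?_
  rw [psi0_of_mem (hθ i), psi0_of_mem (hθ j), heq]

theorem isOptimal_freeMechanism (hc : ∀ i, E.c i = 0) : E.IsOptimal E.freeMechanism := by
  have hF := feasible_freeMechanism hE hψ
  refine ⟨hF, fun M hM => (hM.objective_le hE hc).trans ?_⟩
  rw [freeMechanism_objective_eq hE hψ hc]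
  have h1 : ∀ i, Integrable (fun θ => M.q i θ * E.psi0Formula i (θ i)) E.profileLaw := fun i =>
    (hE.integral_virtualSurplus (hM.isMechanism.q_meas i) (hM.isMechanism.q_mem_Icc i)).1
  have h2 : ∀ i, Integrable (fun θ => allocate E.psi0 i θ * E.psi0Formula i (θ i))
      E.profileLaw := fun i =>
    (hE.integral_virtualSurplus (hF.isMechanism.q_meas i) (hF.isMechanism.q_mem_Icc i)).1
  rw [← integral_finsetSum _ fun i _ => h1 i, ← integral_finsetSum _ fun i _ => h2 i]
  refine integral_mono_ae (integrable_finsetSum _ fun i _ => h1 i)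
    (integrable_finsetSum _ fun i _ => h2 i) ?_
  filter_upwards [ae_psi0Formula_ne hE hψ, hE.ae_profile_Ioo, hE.ae_mem_profiles] with θ hne hθ hθp
  exact sum_mul_le_sum_allocate_mul (w := fun i => E.psi0Formula i (θ i))
    (fun i => psi0_of_mem (hθ i)) hne (fun i => hM.isMechanism.q_nonneg i θ hθp)
    (hM.isMechanism.q_sum θ hθp)

end FreeMechanism

end RoyaltyAuction.Primitives

theorem corollary1 {N : ℕ} (E : RoyaltyAuction.Primitives N) (hE : E.Standing)
    (hc : ∀ i, E.c i = 0)
    (hψ : ∀ i, StrictMonoOn (E.psi0Formula i) (Set.Ioo (E.tlo i) (E.thi i))) :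
    E.IsOptimal E.freeMechanism ∧
    ∀ i, ∀ θ ∈ E.profiles,
      E.cappedMechanism.q i θ = E.freeMechanism.q i θ ∧
      E.cappedMechanism.t i θ = E.freeMechanism.t i θ ∧
      ∀ y' ∈ E.incomes i (θ i),
        E.cappedMechanism.r i θ y' = E.freeMechanism.r i θ y' ∧
        ((y' : EReal) ≠ E.incHi i (θ i) →
          E.cappedMechanism.a i θ y' = E.freeMechanism.a i θ y') ∧
        ∀ y ∈ E.allIncomes i,
          E.cappedMechanism.p i θ y' y = E.freeMechanism.p i θ y' y := by
  refine ⟨RoyaltyAuction.Primitives.isOptimal_freeMechanism hE hψ hc, fun i θ hθ => ⟨?_,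
    hE.cappedMechanism_t_eq hc i hθ, fun y' hy' => ⟨hE.cappedRoyalty_eq hc (hθ i) hy',
      hE.cappedMechanism_a_eq hc i hθ hy', fun y _ => rfl⟩⟩⟩
  exact congrArg (fun v => RoyaltyAuction.Primitives.allocate v i θ) (hE.psi_eq_psi0 hc)
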